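/- **Setting.** Let $\Omega$ be a compact metric space and $T:\Omega\to\Omega$ a finite-to-one map. Let $\mathcal X$ be a real Banach space of bounded Borel functions $\Omega\to\mathbb R$, with norm $\|\cdot\|$, such that: 1. $\mathcal X$ contains the constants and is closed under products, with $\|fg\|\le\|f\|\,\|g\|$; if $f\in\mathcal X$ is positive and bounded away from $0$ then $\log f\in\mathcal X$; and $\|f\|\ge C\sup|f|$ for some constant $C>0$. 2. $f\mapsto f\circ T$ and $f\mapsto\big(x\mapsto\sum_{T(y)=x}f(y)\big)$ are well-defined bounded operators on $\mathcal X$. 3. For $A\in\mathcal X$ let $\mathcal L_Af(x)=\sum_{T(y)=x}e^{A(y)}f(y)$. For every $A\in\mathcal X$ the operator $\mathcal L_A$ has on $\mathcal X$ a positive maximal eigenvalue $\Lambda(A)$ with an eigenfunction $h_A\in\mathcal X$ that is positive and bounded away from $0$; the dual operator $\mathcal L_A^*$ preserves the set of finite measures, and there is a Borel probability measure $\nu_A$ with $\mathcal L_A^*\nu_A=\Lambda(A)\nu_A$. We normalize $h_A$ by $\int h_A\,d\nu_A=1$. 4. For every $A\in\mathcal X$ there are $D>0$ and $\delta\in(0,1)$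 such that $\|\mathcal L_A^nf\|\le D\,\Lambda(A)^n(1-\delta)^n\|f\|$ for all $n\ge0$ and all $f\in\mathcal X$ with $\int f\,d\nu_A=0$. 5. With the Gibbs measure $\mu_A=h_A\nu_A$: if $A,f\in\mathcal X$, $f\ge0$ and $\int f\,d\mu_A=0$, then $f=0$. 6. Every continuous function $\Omega\to\mathbb R$ is a uniform limit of elements of $\mathcal X$. Let $\mathcal P_T$ be the set of $T$-invariant Borel probability measures. For $\mu\in\mathcal P_T$ put $$h_{\mathcal X}(\mu)=\inf_{A\in\mathcal X}\Big(\log\Lambda(A)-\int A\,d\mu\Big).$$ Let $\mathcal C=\{g-g\circ T+c : g\in\mathcal X,\ c\in\mathbb R\}$, let $[\varphi]$ denote the class of $\varphi\in\mathcal X$ in $\mathcal X/\mathcal C$, let $K\ge1$ and $\Phi=(\varphi_1,\dots,\varphi_K)\in\mathcal X^K$, and put $$\operatorname{rv}(\mu)=\Big(\int\varphi_1\,d\mu,\dots,\int\varphi_K\,d\mu\Big),\qquad \operatorname{Rot}(\Phi)=\{\operatorname{rv}(\mu):\mu\in\mathcal P_T\}\subset\mathbb R^K.$$ **Statement.** Suppose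 that $[\varphi_1],\dots,[\varphi_K]$ are linearly independent. Then the infimum defining $h_{\mathcal X}(\mu)$ is finite for every $\mu\in\mathcal P_T$, and the function $$H(w)=\sup\{h_{\mathcal X}(\mu) : \mu\in\mathcal P_T,\ \operatorname{rv}(\mu)=w\}$$ is well defined (a finite supremum over a non-empty set), positive and real-analytic on $\operatorname{int}\operatorname{Rot}(\Phi)$. Moreover there is a real-analytic map $a=(a_1,\dots,a_K):\operatorname{int}\operatorname{Rot}(\Phi)\to\mathbb R^K$ such that, for every $w\in\operatorname{int}\operatorname{Rot}(\Phi)$, $b=a(w)$ is the unique $b\in\mathbb R^K$ with $\operatorname{rv}(\mu_{b_1\varphi_1+\dots+b_K\varphi_K})=w$; and, with $A(w)=\sum_k a_k(w)\varphi_k$, the measure $\mu_{A(w)}$ is $T$-invariant and $$H(w)=h_{\mathcal X}(\mu_{A(w)})=\log\Lambda(A(w))-\sum_{k=1}^K a_k(w)\,w_k .$$ -/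

import Mathlib

open MeasureTheory

noncomputable section

namespace Thermo

/-! A space of potentials on `Ω` is given by a commutative real Banach algebra `X` together with an
algebra homomorphism `ev : X →ₐ[ℝ] (Ω → ℝ)`, which is required to be injective in `Hypotheses`
below, so that `X` is a Banach algebra of functions on `Ω` containing the constants, with
`‖f * g‖ ≤ ‖f‖ * ‖g‖`. -/

/-- The transfer operator `(L_A f)(x) = ∑_{T y = x} exp (A y) * f y`. -/
def transfer {Ω : Type*} (T : Ω → Ω) (A f : Ω → ℝ) : Ω → ℝ :=
  fun x => ∑ᶠ (y : Ω) (_ : T y = x), Real.exp (A y) * f y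

section

variable {Ω X : Type*} [NormedCommRing X] [NormedAlgebra ℝ X]

/-- The (real) eigenvalues of the transfer operator `L_A` acting on `X`. -/
def eigenvalues (T : Ω → Ω) (ev : X →ₐ[ℝ] (Ω → ℝ)) (A : X) : Set ℝ :=
  {c | ∃ f : X, f ≠ 0 ∧ transfer T (ev A) (ev f) = c • ev f}

/-- The maximal eigenvalue `λ_A = Λ(A)` of the transfer operator. -/
def leadingEigenvalue (T : Ω → Ω) (ev : X →ₐ[ℝ] (Ω → ℝ)) (A : X) : ℝ :=
  sSup (eigenvalues T ev A)

/-- The space of functions `g - g ∘ T + c` with `g ∈ X` and `c` a constant. -/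
def coboundaries (T : Ω → Ω) (ev : X →ₐ[ℝ] (Ω → ℝ)) : Submodule ℝ X where
  carrier := {f | ∃ (g : X) (c : ℝ), ∀ x, ev f x = ev g x - ev g (T x) + c}
  zero_mem' := ⟨0, 0, fun x => by simp⟩
  add_mem' := by
    rintro f₁ f₂ ⟨g₁, c₁, h₁⟩ ⟨g₂, c₂, h₂⟩
    refine ⟨g₁ + g₂, c₁ + c₂, fun x => ?_⟩
    simp only [map_add, Pi.add_apply, h₁, h₂]
    ring
  smul_mem' := by
    rintro r f ⟨g, c, h⟩
    refine ⟨r • g, r * c, fun x => ?_⟩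
    simp only [map_smul, Pi.smul_apply, smul_eq_mul, h]
    ring

variable [MeasurableSpace Ω]

/-- `h` is a positive eigenfunction of `L_A` and `ν` an eigenprobability of its dual, both for the
maximal eigenvalue, normalized by `∫ h dν = 1`, and `L_A` has a spectral gap on `{∫ f dν = 0}`. -/
structure IsRPFData (T : Ω → Ω) (ev : X →ₐ[ℝ] (Ω → ℝ)) (A h : X) (ν : Measure Ω) : Prop where
  eigenvalue_pos : 0 < leadingEigenvalue T ev A
  eigenvalue_max : IsGreatest (eigenvalues T ev A) (leadingEigenvalue T ev A)
  bounded_away : ∃ c : ℝ, 0 < c ∧ ∀ x, c ≤ ev h x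
  eigenfunction : transfer T (ev A) (ev h) = leadingEigenvalue T ev A • ev h
  isProbabilityMeasure : IsProbabilityMeasure ν
  eigenmeasure : ∀ f : X,
    ∫ x, transfer T (ev A) (ev f) x ∂ν = leadingEigenvalue T ev A * ∫ x, ev f x ∂ν
  normalized : ∫ x, ev h x ∂ν = 1
  spectral_gap : ∃ D δ : ℝ, 0 < D ∧ 0 < δ ∧ δ < 1 ∧
    ∀ (n : ℕ) (f : X), ∫ x, ev f x ∂ν = 0 →
      ∃ g : X, ev g = (transfer T (ev A))^[n] (ev f) ∧
        ‖g‖ ≤ D * leadingEigenvalue T ev A ^ n * (1 - δ) ^ n * ‖f‖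

/-- `μ = h_A ν_A`. -/
def IsGibbsMeasure (T : Ω → Ω) (ev : X →ₐ[ℝ] (Ω → ℝ)) (A : X) (μ : Measure Ω) : Prop :=
  ∃ (h : X) (ν : Measure Ω), IsRPFData T ev A h ν ∧
    μ = ν.withDensity (fun x => ENNReal.ofReal (ev h x))

open Classical in
/-- The Gibbs measure `μ_A` (and `0` when there is none). -/
def gibbsMeasure (T : Ω → Ω) (ev : X →ₐ[ℝ] (Ω → ℝ)) (A : X) : Measure Ω :=
  if H : ∃ μ, IsGibbsMeasure T ev A μ then H.choose else 0

/-- The working hypotheses on the map `T` and on the space of potentials `X`. -/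
structure Hypotheses [TopologicalSpace Ω] (T : Ω → Ω) (ev : X →ₐ[ℝ] (Ω → ℝ)) : Prop where
  finite_to_one : ∀ x, (T ⁻¹' {x}).Finite
  injective : Function.Injective ev
  measurable : ∀ f : X, Measurable (ev f)
  sup_le : ∃ C : ℝ, 0 < C ∧ ∀ (f : X) (x : Ω), C * |ev f x| ≤ ‖f‖
  log_mem : ∀ f : X, (∃ c : ℝ, 0 < c ∧ ∀ x, c ≤ ev f x) →
    ∃ g : X, ∀ x, ev g x = Real.log (ev f x)
  comp_bounded : ∃ C : ℝ, ∀ f : X, ∃ g : X, (∀ x, ev g x = ev f (T x)) ∧ ‖g‖ ≤ C * ‖f‖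
  sum_bounded : ∃ C : ℝ, ∀ f : X, ∃ g : X,
    (∀ x, ev g x = ∑ᶠ (y : Ω) (_ : T y = x), ev f y) ∧ ‖g‖ ≤ C * ‖f‖
  /-- The dual transfer operators preserve the set of finite measures. -/
  dual_measure : ∀ (A : X) (ν : Measure Ω), IsFiniteMeasure ν →
    ∃ ν' : Measure Ω, IsFiniteMeasure ν' ∧
      ∀ f : X, ∫ x, transfer T (ev A) (ev f) x ∂ν = ∫ x, ev f x ∂ν'
  /-- The Ruelle-Perron-Frobenius property with spectral gap. -/
  rpf : ∀ A : X, ∃ (h : X) (ν : Measure Ω), IsRPFData T ev A h ν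
  faithful : ∀ A f : X, (∀ x, 0 ≤ ev f x) → ∫ x, ev f x ∂(gibbsMeasure T ev A) = 0 → f = 0
  /-- Continuous functions are uniform limits of elements of `X`. -/
  large : ∀ f : C(Ω, ℝ), ∀ ε : ℝ, 0 < ε → ∃ g : X, ∀ x, |f x - ev g x| ≤ ε

/-- The set of `T`-invariant Borel probability measures. -/
def invariantMeasures (T : Ω → Ω) : Set (Measure Ω) :=
  {μ | IsProbabilityMeasure μ ∧ MeasurePreserving T μ μ}

/-- The entropy `inf_A (log λ_A - ∫ A dμ)` of an invariant probability measure. -/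
def entropy (T : Ω → Ω) (ev : X →ₐ[ℝ] (Ω → ℝ)) (μ : Measure Ω) : ℝ :=
  ⨅ A : X, (Real.log (leadingEigenvalue T ev A) - ∫ x, ev A x ∂μ)

/-- The rotation vector `(∫ φ_1 dμ, …, ∫ φ_K dμ)`. -/
def rv {K : ℕ} (ev : X →ₐ[ℝ] (Ω → ℝ)) (φ : Fin K → X) (μ : Measure Ω) : Fin K → ℝ :=
  fun k => ∫ x, ev (φ k) x ∂μ

/-- The rotation set: all rotation vectors of invariant probability measures. -/
def Rot {K : ℕ} (T : Ω → Ω) (ev : X →ₐ[ℝ] (Ω → ℝ)) (φ : Fin K → X) : Set (Fin K → ℝ) :=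
  rv ev φ '' invariantMeasures T

/-- The values of the entropy on the invariant measures with rotation vector `w`. -/
def entropyValues {K : ℕ} (T : Ω → Ω) (ev : X →ₐ[ℝ] (Ω → ℝ)) (φ : Fin K → X)
    (w : Fin K → ℝ) : Set ℝ :=
  entropy T ev '' {μ | μ ∈ invariantMeasures T ∧ rv ev φ μ = w}

/-- `H(w)`, the supremum of the entropy among invariant measures with rotation vector `w`. -/
def maxEntropy {K : ℕ} (T : Ω → Ω) (ev : X →ₐ[ℝ] (Ω → ℝ)) (φ : Fin K → X)
    (w : Fin K → ℝ) : ℝ :=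
  sSup (entropyValues T ev φ w)

end

end Thermo

end

set_option linter.unusedSectionVars false

/-! Along the family `∑ b_k φ_k` the pressure `P(b) = log Λ` is convex and analytic, and `H(w)` is
the minimum over `b` of `P(b) - ⟨b, w⟩`; the map `a` is the inverse of the gradient of `P`.

Up to a coboundary and the constant `log Λ(A)`, each potential is normalized: its transfer operator
fixes `1`. If `u` is the difference of the normalizations of `B` and `A`, then `∫ e^u dμ_A = 1`, and
`e^u ≥ 1 + u` shows that `μ_A` is a subgradient of `log Λ` at `A` (`gibbs_inequality`). So `A`
attains the infimum defining the entropy of `μ_A`, and equality forces `B - A` to be a coboundary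
plus a constant (`sub_mem_coboundaries`).

The spectral gap makes the eigenvalue equation nondegenerate, so the implicit function theorem gives
analyticity (`exists_analyticAt_eigenfunction`), and the gradient of `P` is `gibbsRv`. This gradient
is injective by the equality case, its derivative is injective by a second-order version of it
(`mem_coboundaries_of_tendsto`), and it reaches every interior `w` because `P - ⟨·, w⟩` is coercive
(`exists_gibbsRv_eq`). The inverse function theorem does the rest. Zero entropy would make `T`
injective and, by the spectral gap, every element of `X` constant (`entropy_gibbsMeasure_pos`). -/

namespace Thermo

open Filter Topology

/-! ### Transfer operators and integration as bounded operators on `X` -/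

section Operators

variable {Ω X : Type*} [TopologicalSpace Ω] [MeasurableSpace Ω] [NormedCommRing X]
  [NormedAlgebra ℝ X] {T : Ω → Ω} {ev : X →ₐ[ℝ] (Ω → ℝ)}

namespace Hypotheses

/-- The fibre `T ⁻¹ {x}` as a finite set. -/
noncomputable def fiber (hX : Hypotheses T ev) (x : Ω) : Finset Ω := (hX.finite_to_one x).toFinset

@[simp]
theorem mem_fiber (hX : Hypotheses T ev) {x y : Ω} : y ∈ hX.fiber x ↔ T y = x := by
  simp [fiber]

theorem finsum_fiber (hX : Hypotheses T ev) (f : Ω → ℝ) (x : Ω) :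
    ∑ᶠ (y : Ω) (_ : T y = x), f y = ∑ y ∈ hX.fiber x, f y :=
  finsum_mem_eq_finite_toFinset_sum f (hX.finite_to_one x)

theorem transfer_apply (hX : Hypotheses T ev) (A f : Ω → ℝ) (x : Ω) :
    transfer T A f x = ∑ y ∈ hX.fiber x, Real.exp (A y) * f y :=
  hX.finsum_fiber _ x

theorem ext (hX : Hypotheses T ev) {f g : X} (h : ∀ x, ev f x = ev g x) : f = g :=
  hX.injective (funext h)

theorem exists_abs_ev_le (hX : Hypotheses T ev) :
    ∃ C : ℝ, 0 < C ∧ ∀ (f : X) (x : Ω), |ev f x| ≤ C * ‖f‖ := by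
  obtain ⟨C, hC, h⟩ := hX.sup_le
  refine ⟨C⁻¹, inv_pos.2 hC, fun f x => ?_⟩
  rw [inv_mul_eq_div, le_div_iff₀ hC, mul_comm]
  exact h f x

/-- Evaluation at a point, as a continuous linear functional. -/
noncomputable def evCLM (hX : Hypotheses T ev) (x : Ω) : X →L[ℝ] ℝ :=
  ((LinearMap.proj x).comp ev.toLinearMap).mkContinuous hX.exists_abs_ev_le.choose fun f => by
    simpa using hX.exists_abs_ev_le.choose_spec.2 f x

@[simp]
theorem evCLM_apply (hX : Hypotheses T ev) (x : Ω) (f : X) : hX.evCLM x f = ev f x := rfl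

theorem continuous_ev (hX : Hypotheses T ev) (x : Ω) : Continuous fun f : X => ev f x :=
  (hX.evCLM x).continuous

/-- Evaluation at a point is a continuous ring homomorphism, so it commutes with the exponential
series. This puts the weight `exp A` inside `X`. -/
theorem ev_exp [CompleteSpace X] (hX : Hypotheses T ev) (f : X) (x : Ω) :
    ev (NormedSpace.exp f) x = Real.exp (ev f x) := by
  let _ : NormedAlgebra ℚ X := NormedAlgebra.restrictScalars ℚ ℝ X
  have := NormedSpace.map_exp ((Pi.evalRingHom (fun _ : Ω => ℝ) x).comp ev.toRingHom)
    (hX.continuous_ev x) f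
  rw [Real.exp_eq_exp_ℝ]
  exact this

theorem exists_sumOp (hX : Hypotheses T ev) :
    ∃ S : X →L[ℝ] X, ∀ f x, ev (S f) x = ∑ y ∈ hX.fiber x, ev f y := by
  obtain ⟨C, hC⟩ := hX.sum_bounded
  choose S hS hSn using hC
  simp only [hX.finsum_fiber] at hS
  let L : X →ₗ[ℝ] X :=
    { toFun := S
      map_add' := fun f g => hX.ext fun x => by simp [hS, Finset.sum_add_distrib]
      map_smul' := fun c f => hX.ext fun x => by simp [hS, Finset.mul_sum] }
  exact ⟨L.mkContinuous C hSn, hS⟩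

/-- The operator `f ↦ (x ↦ ∑_{T y = x} f y)`. -/
noncomputable def sumOp (hX : Hypotheses T ev) : X →L[ℝ] X := hX.exists_sumOp.choose

theorem ev_sumOp (hX : Hypotheses T ev) (f : X) (x : Ω) :
    ev (hX.sumOp f) x = ∑ y ∈ hX.fiber x, ev f y := hX.exists_sumOp.choose_spec f x

/-- The transfer operator as a bounded operator on `X`. -/
noncomputable def transferOp (hX : Hypotheses T ev) (A : X) : X →L[ℝ] X :=
  hX.sumOp ∘L ContinuousLinearMap.mul ℝ X (NormedSpace.exp A)

theorem transferOp_apply (hX : Hypotheses T ev) (A f : X) :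
    hX.transferOp A f = hX.sumOp (NormedSpace.exp A * f) := rfl

theorem ev_transferOp [CompleteSpace X] (hX : Hypotheses T ev) (A f : X) :
    ev (hX.transferOp A f) = transfer T (ev A) (ev f) := by
  ext x
  simp [transferOp_apply, hX.ev_sumOp, hX.transfer_apply, hX.ev_exp]

theorem ev_transferOp_pow [CompleteSpace X] (hX : Hypotheses T ev) (A f : X) (n : ℕ) :
    ev ((hX.transferOp A ^ n) f) = (transfer T (ev A))^[n] (ev f) := by
  induction n with
  | zero => simp
  | succ n ih => rw [pow_succ', Function.iterate_succ_apply', ← ih, ← hX.ev_transferOp]; rfl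

theorem integrable (hX : Hypotheses T ev) (μ : Measure Ω) [IsFiniteMeasure μ] (f : X) :
    Integrable (ev f) μ := by
  obtain ⟨C, -, hC⟩ := hX.exists_abs_ev_le
  exact Integrable.of_bound (hX.measurable f).aestronglyMeasurable (C * ‖f‖)
    (ae_of_all _ fun x => by simpa using hC f x)

/-- Integration against a finite measure, as a continuous linear functional. -/
noncomputable def integralCLM (hX : Hypotheses T ev) (μ : Measure Ω) [IsFiniteMeasure μ] :
    X →L[ℝ] ℝ :=
  LinearMap.mkContinuous
    { toFun := fun f => ∫ x, ev f x ∂μ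
      map_add' := fun f g => by
        simpa using integral_add (hX.integrable μ f) (hX.integrable μ g)
      map_smul' := fun c f => by simp [integral_const_mul] }
    (hX.exists_abs_ev_le.choose * μ.real Set.univ) fun f => by
      have := norm_integral_le_of_norm_le_const (μ := μ) (f := ev f)
        (ae_of_all _ fun x => by simpa using hX.exists_abs_ev_le.choose_spec.2 f x)
      refine this.trans_eq (by ring)

@[simp]
theorem integralCLM_apply (hX : Hypotheses T ev) (μ : Measure Ω) [IsFiniteMeasure μ] (f : X) :
    hX.integralCLM μ f = ∫ x, ev f x ∂μ := rfl

theorem exists_comp (hX : Hypotheses T ev) (f : X) : ∃ g : X, ∀ x, ev g x = ev f (T x) := by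
  obtain ⟨C, hC⟩ := hX.comp_bounded
  obtain ⟨g, hg, -⟩ := hC f
  exact ⟨g, hg⟩

theorem isGibbsMeasure (hX : Hypotheses T ev) (A : X) :
    IsGibbsMeasure T ev A (gibbsMeasure T ev A) := by
  have H : ∃ μ, IsGibbsMeasure T ev A μ := by
    obtain ⟨h, ν, H⟩ := hX.rpf A
    exact ⟨_, h, ν, H, rfl⟩
  rw [gibbsMeasure, dif_pos H]
  exact H.choose_spec

theorem leadingEigenvalue_pos (hX : Hypotheses T ev) (A : X) : 0 < leadingEigenvalue T ev A := by
  obtain ⟨h, ν, H⟩ := hX.rpf A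
  exact H.eigenvalue_pos

/-- A positive eigenfunction belongs to the leading eigenvalue. -/
theorem eq_leadingEigenvalue [CompleteSpace X] (hX : Hypotheses T ev) {A f : X} {r : ℝ}
    (hf : ∃ c : ℝ, 0 < c ∧ ∀ x, c ≤ ev f x) (h : hX.transferOp A f = r • f) :
    r = leadingEigenvalue T ev A := by
  obtain ⟨c, hc, hcf⟩ := hf
  obtain ⟨_, ν, H⟩ := hX.rpf A
  have := H.isProbabilityMeasure
  have h1 := H.eigenmeasure f
  rw [← hX.ev_transferOp, h] at h1
  simp only [map_smul, Pi.smul_apply, smul_eq_mul, integral_const_mul] at h1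
  -- Integrating the eigenvalue equation against `ν` gives `r ∫ f = Λ(A) ∫ f`; positivity of `f`
  -- allows cancelling.
  have h2 : c ≤ ∫ x, ev f x ∂ν := by
    simpa using integral_mono (integrable_const c) (hX.integrable ν f) hcf
  exact mul_right_cancel₀ (hc.trans_le h2).ne' h1

end Hypotheses

theorem integral_withDensity_eigenfunction (hX : Hypotheses T ev) {A h : X} {ν : Measure Ω}
    (H : IsRPFData T ev A h ν) (f : Ω → ℝ) :
    ∫ x, f x ∂(ν.withDensity fun x => ENNReal.ofReal (ev h x)) = ∫ x, ev h x * f x ∂ν := by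
  obtain ⟨c, hc, hch⟩ := H.bounded_away
  rw [integral_withDensity_eq_integral_toReal_smul (hX.measurable h).ennreal_ofReal (by simp)]
  congr with x
  rw [ENNReal.toReal_ofReal (hc.le.trans (hch x)), smul_eq_mul]

theorem isProbabilityMeasure_withDensity (hX : Hypotheses T ev) {A h : X} {ν : Measure Ω}
    (H : IsRPFData T ev A h ν) :
    IsProbabilityMeasure (ν.withDensity fun x => ENNReal.ofReal (ev h x)) := by
  have := H.isProbabilityMeasure
  obtain ⟨c, hc, hch⟩ := H.bounded_away
  constructor
  rw [withDensity_apply _ MeasurableSet.univ, setLIntegral_univ,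
    ← ofReal_integral_eq_lintegral_ofReal (hX.integrable ν h)
      (ae_of_all _ fun x => hc.le.trans (hch x)), H.normalized, ENNReal.ofReal_one]

theorem Hypotheses.isProbabilityMeasure_gibbs (hX : Hypotheses T ev) (A : X) :
    IsProbabilityMeasure (gibbsMeasure T ev A) := by
  obtain ⟨h, ν, H, e⟩ := hX.isGibbsMeasure A
  rw [e]
  exact isProbabilityMeasure_withDensity hX H

end Operators

end Thermo

/-! ### Normalized potentials, the Gibbs inequality and entropy -/

namespace Thermo

open Filter Topology

section Normalization

variable {Ω X : Type*} [MetricSpace Ω] [CompactSpace Ω] [MeasurableSpace Ω] [BorelSpace Ω]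
  [NormedCommRing X] [NormedAlgebra ℝ X] [CompleteSpace X] {T : Ω → Ω} {ev : X →ₐ[ℝ] (Ω → ℝ)}

/-- `B = A + g - g ∘ T - log Λ(A)` is a normalized potential cohomologous to `A`. -/
structure IsNormalization (T : Ω → Ω) (ev : X →ₐ[ℝ] (Ω → ℝ)) (A g B : X) : Prop where
  ev_eq : ∀ x, ev B x = ev A x + ev g x - ev g (T x) - Real.log (leadingEigenvalue T ev A)
  transfer_one : ∀ x, transfer T (ev B) 1 x = 1

namespace Hypotheses

/-- On the fibre over `x` the term `g ∘ T` is the constant `g x`, so it leaves the sum together with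
`Λ(A)`. -/
theorem transfer_of_ev_eq (hX : Hypotheses T ev) {A g B : X}
    (h : ∀ x, ev B x = ev A x + ev g x - ev g (T x) - Real.log (leadingEigenvalue T ev A))
    (F : Ω → ℝ) (x : Ω) :
    transfer T (ev B) F x = transfer T (ev A) (fun y => Real.exp (ev g y) * F y) x /
      (leadingEigenvalue T ev A * Real.exp (ev g x)) := by
  rw [hX.transfer_apply, hX.transfer_apply, Finset.sum_div]
  refine Finset.sum_congr rfl fun y hy => ?_
  rw [hX.mem_fiber] at hy
  rw [h, hy, Real.exp_sub, Real.exp_sub, Real.exp_add, Real.exp_log (hX.leadingEigenvalue_pos A)]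
  field_simp

/-- With `g = log f`, adding `g - g ∘ T - log Λ(A)` conjugates `L_A` by multiplication by `f` and
divides it by `Λ(A)`; the eigenfunction `f` becomes `1`. -/
theorem exists_normalization (hX : Hypotheses T ev) {A f : X}
    (hf : ∃ c : ℝ, 0 < c ∧ ∀ x, c ≤ ev f x)
    (h : hX.transferOp A f = leadingEigenvalue T ev A • f) :
    ∃ g B : X, (∀ x, Real.exp (ev g x) = ev f x) ∧ IsNormalization T ev A g B := by
  obtain ⟨g, hg⟩ := hX.log_mem f hf
  obtain ⟨c, hc, hcf⟩ := hf
  obtain ⟨k, hk⟩ := hX.exists_comp g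
  have hexp : ∀ x, Real.exp (ev g x) = ev f x := fun x => by
    rw [hg, Real.exp_log (hc.trans_le (hcf x))]
  have hB : ∀ x, ev (A + g - k - algebraMap ℝ X (Real.log (leadingEigenvalue T ev A))) x =
      ev A x + ev g x - ev g (T x) - Real.log (leadingEigenvalue T ev A) := fun x => by
    simp [hk]
  refine ⟨g, _, hexp, hB, fun x => ?_⟩
  rw [hX.transfer_of_ev_eq hB]
  have h1 := congrFun (congrArg ev h) x
  rw [hX.ev_transferOp] at h1
  simp only [hexp, Pi.one_apply, mul_one]
  rw [h1, map_smul, Pi.smul_apply, smul_eq_mul, div_self]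
  exact (mul_pos (hX.leadingEigenvalue_pos A) (hc.trans_le (hcf x))).ne'

theorem transferOp_eigenfunction (hX : Hypotheses T ev) {A h : X} {ν : Measure Ω}
    (H : IsRPFData T ev A h ν) : hX.transferOp A h = leadingEigenvalue T ev A • h :=
  hX.injective (by rw [hX.ev_transferOp, H.eigenfunction, map_smul])

theorem exists_isNormalization (hX : Hypotheses T ev) (A : X) :
    ∃ g B : X, IsNormalization T ev A g B := by
  obtain ⟨h, ν, H⟩ := hX.rpf A
  obtain ⟨g, B, -, hB⟩ := hX.exists_normalization H.bounded_away (hX.transferOp_eigenfunction H)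
  exact ⟨g, B, hB⟩

/-- Since `h · L_B f = Λ(A)⁻¹ L_A (h f)`, the eigenmeasure relation for `ν` turns into invariance of
`h ν` under the dual of `L_B`. -/
theorem integral_transfer_gibbs (hX : Hypotheses T ev) {A h g B : X} {ν : Measure Ω}
    (H : IsRPFData T ev A h ν)
    (e : gibbsMeasure T ev A = ν.withDensity fun x => ENNReal.ofReal (ev h x))
    (hg : ∀ x, Real.exp (ev g x) = ev h x) (hB : IsNormalization T ev A g B) (f : X) :
    ∫ x, transfer T (ev B) (ev f) x ∂(gibbsMeasure T ev A) =
      ∫ x, ev f x ∂(gibbsMeasure T ev A) := by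
  have hΛ := hX.leadingEigenvalue_pos A
  obtain ⟨c, hc, hch⟩ := H.bounded_away
  rw [e, integral_withDensity_eigenfunction hX H, integral_withDensity_eigenfunction hX H]
  have h1 : ∀ x, ev h x * transfer T (ev B) (ev f) x =
      (leadingEigenvalue T ev A)⁻¹ * transfer T (ev A) (ev (h * f)) x := fun x => by
    have h2 : (fun y => Real.exp (ev g y) * ev f y) = ev (h * f) := by
      ext y
      simp [hg]
    rw [hX.transfer_of_ev_eq hB.ev_eq, h2, hg]
    have := (hc.trans_le (hch x)).ne'
    field_simp
  simp_rw [h1]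
  rw [integral_const_mul, H.eigenmeasure, inv_mul_cancel_left₀ hΛ.ne']
  simp

/-- The normalization of `A` by the density of its Gibbs measure. -/
theorem exists_gibbs_normalization (hX : Hypotheses T ev) (A : X) :
    ∃ g B : X, IsNormalization T ev A g B ∧ ∀ f : X,
      ∫ x, transfer T (ev B) (ev f) x ∂(gibbsMeasure T ev A) =
        ∫ x, ev f x ∂(gibbsMeasure T ev A) := by
  obtain ⟨h, ν, H, e⟩ := hX.isGibbsMeasure A
  obtain ⟨g, B, hg, hB⟩ := hX.exists_normalization H.bounded_away (hX.transferOp_eigenfunction H)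
  exact ⟨g, B, hB, hX.integral_transfer_gibbs H e hg hB⟩

theorem exists_seq_tendsto (hX : Hypotheses T ev) (f : C(Ω, ℝ)) :
    ∃ g : ℕ → X, ∀ n x, |f x - ev (g n) x| ≤ 1 / ((n : ℝ) + 1) := by
  choose g hg using fun n : ℕ => hX.large f (1 / ((n : ℝ) + 1)) (by positivity)
  exact ⟨g, hg⟩

/-- For continuous `f`, `f ∘ T` is a uniform limit of the measurable functions `g ∘ T`, `g ∈ X`.
Distance functions then show that preimages of closed sets are measurable. -/
theorem measurable_map (hX : Hypotheses T ev) : Measurable T := by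
  have key : ∀ f : C(Ω, ℝ), Measurable fun x => f (T x) := fun f => by
    obtain ⟨g, hg⟩ := hX.exists_seq_tendsto f
    choose k hk using fun n => hX.exists_comp (g n)
    refine measurable_of_tendsto_metrizable (fun n => hX.measurable (k n))
      (tendsto_pi_nhds.2 fun x => ?_)
    simp only [hk]
    refine tendsto_iff_dist_tendsto_zero.2 (squeeze_zero (fun n => dist_nonneg) (fun n => ?_)
      tendsto_one_div_add_atTop_nhds_zero_nat)
    rw [dist_comm]
    exact hg n (T x)
  refine measurable_of_isClosed fun F hF => ?_
  rcases F.eq_empty_or_nonempty with rfl | hne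
  · simp
  have h1 : T ⁻¹' F = (fun x => Metric.infDist (T x) F) ⁻¹' {0} := by
    ext x
    simp [hF.mem_iff_infDist_zero hne]
  rw [h1]
  exact key ⟨_, Metric.continuous_infDist_pt F⟩ (measurableSet_singleton 0)

theorem measure_ext (hX : Hypotheses T ev) {μ ν : Measure Ω} [IsProbabilityMeasure μ]
    [IsProbabilityMeasure ν] (h : ∀ f : X, ∫ x, ev f x ∂μ = ∫ x, ev f x ∂ν) : μ = ν := by
  refine ext_of_forall_integral_eq_of_IsFiniteMeasure fun f => ?_
  obtain ⟨g, hg⟩ := hX.exists_seq_tendsto f.toContinuousMap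
  have key : ∀ (ρ : Measure Ω) [IsProbabilityMeasure ρ],
      Tendsto (fun n => ∫ x, ev (g n) x ∂ρ) atTop (𝓝 (∫ x, f x ∂ρ)) := fun ρ _ => by
    refine tendsto_iff_dist_tendsto_zero.2 (squeeze_zero (fun n => dist_nonneg) (fun n => ?_)
      tendsto_one_div_add_atTop_nhds_zero_nat)
    rw [dist_comm, Real.dist_eq, ← integral_sub (f.integrable ρ) (hX.integrable ρ _)]
    simpa using norm_integral_le_of_norm_le_const (μ := ρ) (f := fun x => f x - ev (g n) x)
      (ae_of_all _ fun x => by simpa using hg n x)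
  refine tendsto_nhds_unique (key μ) ?_
  simp_rw [h]
  exact key ν

/-- For the normalized potential, `L_B (f ∘ T) = f · L_B 1 = f`; integrate against `μ_A`, which the
dual of `L_B` fixes. -/
theorem gibbsMeasure_mem_invariantMeasures (hX : Hypotheses T ev) (A : X) :
    gibbsMeasure T ev A ∈ invariantMeasures T := by
  have := hX.isProbabilityMeasure_gibbs A
  have hT := hX.measurable_map
  refine ⟨this, hT, ?_⟩
  have := Measure.isProbabilityMeasure_map (μ := gibbsMeasure T ev A) hT.aemeasurable
  refine hX.measure_ext fun f => ?_
  obtain ⟨g, B, hB, hi⟩ := hX.exists_gibbs_normalization A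
  obtain ⟨k, hk⟩ := hX.exists_comp f
  have hk' : transfer T (ev B) (ev k) = ev f := by
    ext x
    rw [← one_mul (ev f x), ← hB.transfer_one x, hX.transfer_apply, hX.transfer_apply,
      Finset.sum_mul]
    refine Finset.sum_congr rfl fun y hy => ?_
    rw [hk, hX.mem_fiber.1 hy, Pi.one_apply, mul_one]
  rw [integral_map hT.aemeasurable (hX.measurable f).aestronglyMeasurable]
  simp_rw [← hk]
  rw [← hi k, hk']

theorem integral_comp (hX : Hypotheses T ev) {μ : Measure Ω} (hμ : μ ∈ invariantMeasures T)
    (f : X) : ∫ x, ev f (T x) ∂μ = ∫ x, ev f x ∂μ := by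
  conv_rhs => rw [← hμ.2.map_eq]
  rw [integral_map hμ.2.measurable.aemeasurable (hX.measurable f).aestronglyMeasurable]

theorem integral_normalization (hX : Hypotheses T ev) {μ : Measure Ω}
    (hμ : μ ∈ invariantMeasures T) {A g B : X} (hB : IsNormalization T ev A g B) :
    ∫ x, ev B x ∂μ = ∫ x, ev A x ∂μ - Real.log (leadingEigenvalue T ev A) := by
  have := hμ.1
  obtain ⟨k, hk⟩ := hX.exists_comp g
  have hBk : B = A + g - k - algebraMap ℝ X (Real.log (leadingEigenvalue T ev A)) :=
    hX.ext fun x => by simp [hB.ev_eq, hk]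
  have h1 : hX.integralCLM μ k = hX.integralCLM μ g := by
    simp only [integralCLM_apply, hk, hX.integral_comp hμ]
  have h2 : hX.integralCLM μ (algebraMap ℝ X (Real.log (leadingEigenvalue T ev A))) =
      Real.log (leadingEigenvalue T ev A) := by simp
  have h3 := congrArg (hX.integralCLM μ) hBk
  rw [map_sub, map_sub, map_add, h1, h2] at h3
  simpa using h3

/-- The weights `exp B` over a fibre are positive and sum to `1`, so each is at most `1`. -/
theorem normalization_nonpos (hX : Hypotheses T ev) {A g B : X}
    (hB : IsNormalization T ev A g B) (x : Ω) : ev B x ≤ 0 := by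
  have h1 := hB.transfer_one (T x)
  rw [hX.transfer_apply] at h1
  have h2 := Finset.single_le_sum (f := fun y => Real.exp (ev B y) * (1 : Ω → ℝ) y)
    (fun y _ => by simpa using (Real.exp_pos _).le) (hX.mem_fiber.2 (rfl : T x = T x))
  rw [h1] at h2
  simpa using h2

theorem integral_le_log_leadingEigenvalue (hX : Hypotheses T ev) {μ : Measure Ω}
    (hμ : μ ∈ invariantMeasures T) (A : X) :
    ∫ x, ev A x ∂μ ≤ Real.log (leadingEigenvalue T ev A) := by
  obtain ⟨g, B, hB⟩ := hX.exists_isNormalization A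
  have h1 := hX.integral_normalization hμ hB
  have h2 : ∫ x, ev B x ∂μ ≤ 0 := integral_nonpos fun x => hX.normalization_nonpos hB x
  linarith

theorem bddBelow_range (hX : Hypotheses T ev) {μ : Measure Ω} (hμ : μ ∈ invariantMeasures T) :
    BddBelow (Set.range fun A : X =>
      Real.log (leadingEigenvalue T ev A) - ∫ x, ev A x ∂μ) := by
  refine ⟨0, ?_⟩
  rintro _ ⟨A, rfl⟩
  exact sub_nonneg.2 (hX.integral_le_log_leadingEigenvalue hμ A)

theorem transfer_exp_sub (hX : Hypotheses T ev) (A B : X) (x : Ω) :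
    transfer T (ev A) (ev (NormedSpace.exp (B - A))) x = transfer T (ev B) 1 x := by
  rw [hX.transfer_apply, hX.transfer_apply]
  refine Finset.sum_congr rfl fun y _ => ?_
  rw [hX.ev_exp, ← Real.exp_add]
  simp

/-- The defect in the Gibbs inequality. -/
theorem integral_exp_sub (hX : Hypotheses T ev) {A gA A' B gB B' : X}
    (hA : IsNormalization T ev A gA A') (hi : ∀ f : X,
      ∫ x, transfer T (ev A') (ev f) x ∂(gibbsMeasure T ev A) =
        ∫ x, ev f x ∂(gibbsMeasure T ev A))
    (hB : IsNormalization T ev B gB B') :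
    ∫ x, ev (NormedSpace.exp (B' - A') - 1 - (B' - A')) x ∂(gibbsMeasure T ev A) =
      Real.log (leadingEigenvalue T ev B) - Real.log (leadingEigenvalue T ev A) -
        ∫ x, ev (B - A) x ∂(gibbsMeasure T ev A) := by
  have hμ := hX.gibbsMeasure_mem_invariantMeasures A
  have := hμ.1
  set μ := gibbsMeasure T ev A
  -- By duality this is the integral of `L_{A'} e^{B' - A'} = L_{B'} 1 = 1`.
  have h1 : hX.integralCLM μ (NormedSpace.exp (B' - A')) = 1 := by
    rw [integralCLM_apply, ← hi]
    simp [hX.transfer_exp_sub, hB.transfer_one]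
  have h2 : hX.integralCLM μ 1 = 1 := by simp
  have h3 := hX.integral_normalization hμ hA
  have h4 := hX.integral_normalization hμ hB
  simp only [← hX.integralCLM_apply μ] at h3 h4 ⊢
  rw [map_sub, map_sub, map_sub, map_sub, h1, h2, h3, h4]
  ring

theorem ev_exp_sub_nonneg (hX : Hypotheses T ev) (u : X) (x : Ω) :
    0 ≤ ev (NormedSpace.exp u - 1 - u) x := by
  have := Real.add_one_le_exp (ev u x)
  simp only [map_sub, map_one, Pi.sub_apply, Pi.one_apply, hX.ev_exp]
  linarith

/-- The Gibbs measure is a subgradient of the pressure. -/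
theorem gibbs_inequality (hX : Hypotheses T ev) (A B : X) :
    ∫ x, ev (B - A) x ∂(gibbsMeasure T ev A) ≤
      Real.log (leadingEigenvalue T ev B) - Real.log (leadingEigenvalue T ev A) := by
  obtain ⟨gA, A', hA, hi⟩ := hX.exists_gibbs_normalization A
  obtain ⟨gB, B', hB⟩ := hX.exists_isNormalization B
  have h1 := hX.integral_exp_sub hA hi hB
  have h2 : 0 ≤ ∫ x, ev (NormedSpace.exp (B' - A') - 1 - (B' - A')) x ∂(gibbsMeasure T ev A) :=
    integral_nonneg fun x => hX.ev_exp_sub_nonneg _ x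
  linarith

/-- Equality in the Gibbs inequality makes the nonnegative function `e^u - 1 - u`, `u = B' - A'`,
have integral zero. Faithfulness gives `u = 0` everywhere, and `u` differs from `B - A` by a
coboundary and a constant. -/
theorem sub_mem_coboundaries (hX : Hypotheses T ev) {A B : X}
    (h : ∫ x, ev (B - A) x ∂(gibbsMeasure T ev A) =
      Real.log (leadingEigenvalue T ev B) - Real.log (leadingEigenvalue T ev A)) :
    B - A ∈ coboundaries T ev := by
  obtain ⟨gA, A', hA, hi⟩ := hX.exists_gibbs_normalization A
  obtain ⟨gB, B', hB⟩ := hX.exists_isNormalization B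
  have h1 := hX.integral_exp_sub hA hi hB
  rw [h, sub_self] at h1
  have h2 := hX.faithful A _ (hX.ev_exp_sub_nonneg _) h1
  refine ⟨gA - gB, Real.log (leadingEigenvalue T ev B) - Real.log (leadingEigenvalue T ev A),
    fun x => ?_⟩
  have h3 := congrFun (congrArg ev h2) x
  have h4 : ev (B' - A') x = 0 := by
    by_contra h4
    have := Real.add_one_lt_exp h4
    simp only [map_sub, map_one, Pi.sub_apply, Pi.one_apply, hX.ev_exp, map_zero,
      Pi.zero_apply] at h3 this
    linarith
  simp only [map_sub, Pi.sub_apply, hA.ev_eq, hB.ev_eq] at h4 ⊢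
  linarith

theorem entropy_le (hX : Hypotheses T ev) {μ : Measure Ω} (hμ : μ ∈ invariantMeasures T) (A : X) :
    entropy T ev μ ≤ Real.log (leadingEigenvalue T ev A) - ∫ x, ev A x ∂μ :=
  ciInf_le (hX.bddBelow_range hμ) A

/-- The Gibbs inequality says precisely that the infimum is attained at `A`. -/
theorem entropy_gibbsMeasure (hX : Hypotheses T ev) (A : X) :
    entropy T ev (gibbsMeasure T ev A) =
      Real.log (leadingEigenvalue T ev A) - ∫ x, ev A x ∂(gibbsMeasure T ev A) := by
  have hμ := hX.gibbsMeasure_mem_invariantMeasures A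
  have := hμ.1
  refine le_antisymm (hX.entropy_le hμ A) (le_ciInf fun B => ?_)
  have h1 := hX.gibbs_inequality A B
  rw [← hX.integralCLM_apply, map_sub] at h1
  simp only [integralCLM_apply] at h1
  linarith

/-- If the entropy vanished, the normalized potential, which is nonpositive, would have integral
zero and hence be `0`. Then every fibre has one point and `L_0` merely transports values along `T`,
which the spectral gap permits only if mean-zero functions vanish, that is, if `X` consists of
constants. -/
theorem entropy_gibbsMeasure_pos (hX : Hypotheses T ev) (A : X) (hne : coboundaries T ev ≠ ⊤) :
    0 < entropy T ev (gibbsMeasure T ev A) := by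
  have hμ := hX.gibbsMeasure_mem_invariantMeasures A
  have := hμ.1
  rw [hX.entropy_gibbsMeasure, sub_pos]
  refine lt_of_le_of_ne (hX.integral_le_log_leadingEigenvalue hμ A) fun h => hne ?_
  obtain ⟨g, B, hB, -⟩ := hX.exists_gibbs_normalization A
  have h1 := hX.integral_normalization hμ hB
  rw [h, sub_self] at h1
  have h2 : -B = 0 := hX.faithful A _ (fun x => by
    simpa using hX.normalization_nonpos hB x) (by simp [integral_neg, h1])
  obtain rfl : B = 0 := neg_eq_zero.1 h2
  have hcard : ∀ x, (hX.fiber x).card = 1 := fun x => by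
    have := hB.transfer_one x
    rw [hX.transfer_apply] at this
    simpa using this
  have hinj : Function.Injective T := fun x y hxy => by
    obtain ⟨z, hz⟩ := Finset.card_eq_one.1 (hcard (T y))
    have hx := (hX.mem_fiber (x := T y)).2 hxy
    have hy := (hX.mem_fiber (x := T y)).2 (rfl : T y = T y)
    rw [hz, Finset.mem_singleton] at hx hy
    rw [hx, hy]
  have hT : ∀ (f : Ω → ℝ) (x : Ω), transfer T (ev (0 : X)) f (T x) = f x := fun f x => by
    rw [hX.transfer_apply]
    have : hX.fiber (T x) = {x} := by
      ext y
      simp [hinj.eq_iff]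
    simp [this]
  have hTn : ∀ (n : ℕ) (f : Ω → ℝ) (x : Ω), (transfer T (ev (0 : X)))^[n] f (T^[n] x) = f x := by
    intro n
    induction n with
    | zero => simp
    | succ n ih =>
      intro f x
      rw [Function.iterate_succ_apply', Function.iterate_succ_apply', hT, ih]
  obtain ⟨h, ν, H⟩ := hX.rpf 0
  have := H.isProbabilityMeasure
  have hΛ : leadingEigenvalue T ev (0 : X) = 1 := by
    refine (hX.eq_leadingEigenvalue (f := 1) (r := 1) ⟨1, one_pos, by simp⟩
      (hX.ext fun x => ?_)).symm
    rw [hX.ev_transferOp]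
    simpa using hB.transfer_one x
  obtain ⟨D, δ, hD, hδ, hδ1, hgap⟩ := H.spectral_gap
  obtain ⟨C, hC, hCf⟩ := hX.exists_abs_ev_le
  -- The value `f x` reappears as that of `L_0^n f` at `T^n x`, whose norm decays exponentially.
  have hzero : ∀ f : X, ∫ x, ev f x ∂ν = 0 → ∀ x, ev f x = 0 := fun f hf x => by
    have hb : ∀ n : ℕ, |ev f x| ≤ C * (D * (1 - δ) ^ n * ‖f‖) := fun n => by
      obtain ⟨k, hk, hkn⟩ := hgap n f hf
      rw [hΛ, one_pow, mul_one] at hkn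
      rw [← hTn n (ev f) x, ← hk]
      exact (hCf k _).trans (mul_le_mul_of_nonneg_left hkn hC.le)
    have hlim : Tendsto (fun n : ℕ => C * (D * (1 - δ) ^ n * ‖f‖)) atTop (𝓝 (C * (D * 0 * ‖f‖))) :=
      (((tendsto_pow_atTop_nhds_zero_of_lt_one (by linarith) (by linarith)).const_mul D).mul_const
        ‖f‖).const_mul C
    have := ge_of_tendsto' hlim hb
    simpa using this
  refine eq_top_iff.2 fun f _ => ⟨0, ∫ x, ev f x ∂ν, fun x => ?_⟩
  have := hzero (f - algebraMap ℝ X (∫ x, ev f x ∂ν)) (by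
    rw [← hX.integralCLM_apply, map_sub]; simp) x
  simp only [map_sub, AlgHom.commutes, Pi.sub_apply, Pi.algebraMap_apply, Algebra.algebraMap_self,
    RingHom.id_apply, sub_eq_zero] at this
  simpa using this

end Hypotheses

end Normalization

end Thermo

/-! ### Analytic perturbation of the leading eigenvalue -/

namespace Thermo

open Filter Topology
open scoped ContDiff

section Perturbation

variable {Ω X : Type*} [MetricSpace Ω] [CompactSpace Ω] [MeasurableSpace Ω] [BorelSpace Ω]
  [NormedCommRing X] [NormedAlgebra ℝ X] [CompleteSpace X] {T : Ω → Ω} {ev : X →ₐ[ℝ] (Ω → ℝ)}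

namespace Hypotheses

theorem norm_transferOp_pow_le (hX : Hypotheses T ev) {A h : X} {ν : Measure Ω}
    (H : IsRPFData T ev A h ν) : ∃ D r : ℝ, 0 < D ∧ 0 ≤ r ∧ r < 1 ∧ ∀ (n : ℕ) (f : X),
      ∫ x, ev f x ∂ν = 0 →
        ‖(hX.transferOp A ^ n) f‖ ≤ D * (leadingEigenvalue T ev A * r) ^ n * ‖f‖ := by
  obtain ⟨D, δ, hD, hδ, hδ1, hgap⟩ := H.spectral_gap
  refine ⟨D, 1 - δ, hD, by linarith, by linarith, fun n f hf => ?_⟩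
  obtain ⟨g, hg, hgn⟩ := hgap n f hf
  rw [← hX.ev_transferOp_pow] at hg
  rwa [← hX.injective hg, mul_pow, ← mul_assoc]

theorem integral_transferOp (hX : Hypotheses T ev) {A h : X} {ν : Measure Ω}
    (H : IsRPFData T ev A h ν) (f : X) :
    ∫ x, ev (hX.transferOp A f) x ∂ν = leadingEigenvalue T ev A * ∫ x, ev f x ∂ν := by
  rw [hX.ev_transferOp, H.eigenmeasure]

/-- On mean-zero functions the iterates grow strictly slower than `Λ(A)^n`, the exact growth of an
eigenfunction. -/
theorem eq_zero_of_transferOp_eq (hX : Hypotheses T ev) {A h f : X} {ν : Measure Ω}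
    (H : IsRPFData T ev A h ν) (hf : ∫ x, ev f x ∂ν = 0)
    (e : hX.transferOp A f = leadingEigenvalue T ev A • f) : f = 0 := by
  obtain ⟨D, r, hD, hr, hr1, hgap⟩ := hX.norm_transferOp_pow_le H
  have hΛ := hX.leadingEigenvalue_pos A
  have hpow : ∀ n : ℕ, (hX.transferOp A ^ n) f = leadingEigenvalue T ev A ^ n • f := fun n => by
    induction n with
    | zero => simp
    | succ n ih => rw [pow_succ', mul_apply_eq_comp, ih, map_smul, e, smul_smul, pow_succ]
  have hb : ∀ n : ℕ, ‖f‖ ≤ D * r ^ n * ‖f‖ := fun n => by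
    have h1 := hgap n f hf
    rw [hpow, norm_smul, Real.norm_of_nonneg (pow_nonneg hΛ.le n), mul_pow] at h1
    refine le_of_mul_le_mul_left (h1.trans_eq ?_) (pow_pos hΛ n)
    ring
  have hlim : Tendsto (fun n : ℕ => D * r ^ n * ‖f‖) atTop (𝓝 (D * 0 * ‖f‖)) :=
    ((tendsto_pow_atTop_nhds_zero_of_lt_one hr hr1).const_mul D).mul_const ‖f‖
  simpa using ge_of_tendsto' hlim hb

/-- The Neumann series `-Λ⁻¹ ∑ Λ⁻ⁿ L_Aⁿ y` converges by the spectral gap and telescopes to a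
solution. -/
theorem exists_transferOp_sub_eq (hX : Hypotheses T ev) {A h y : X} {ν : Measure Ω}
    (H : IsRPFData T ev A h ν) (hy : ∫ x, ev y x ∂ν = 0) :
    ∃ g : X, hX.transferOp A g - leadingEigenvalue T ev A • g = y := by
  obtain ⟨D, r, hD, hr, hr1, hgap⟩ := hX.norm_transferOp_pow_le H
  have hΛ := hX.leadingEigenvalue_pos A
  set Λ := leadingEigenvalue T ev A
  set a : ℕ → X := fun n => (Λ ^ n)⁻¹ • (hX.transferOp A ^ n) y with ha
  have hsum : Summable a := by
    refine Summable.of_norm_bounded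
      ((summable_geometric_of_lt_one hr hr1).mul_left (D * ‖y‖)) fun n => ?_
    rw [norm_smul, norm_inv, Real.norm_of_nonneg (pow_nonneg hΛ.le n),
      inv_mul_le_iff₀ (pow_pos hΛ n)]
    refine (hgap n y hy).trans_eq ?_
    rw [mul_pow]
    ring
  have hstep : ∀ n, hX.transferOp A (a n) = Λ • a (n + 1) := fun n => by
    rw [ha]
    simp only [map_smul]
    rw [pow_succ' (hX.transferOp A), mul_apply_eq_comp, smul_smul]
    congr 1
    field_simp
    exact pow_succ Λ n
  refine ⟨-Λ⁻¹ • ∑' n, a n, ?_⟩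
  have h1 : hX.transferOp A (∑' n, a n) = Λ • ∑' n, a (n + 1) := by
    rw [(hX.transferOp A).map_tsum hsum, ← tsum_const_smul'']
    exact tsum_congr hstep
  rw [map_smul, h1, hsum.tsum_eq_zero_add]
  have h0 : a 0 = y := by simp [ha]
  rw [h0, smul_smul, smul_smul, smul_add]
  have : Λ * -Λ⁻¹ = -1 := by field_simp
  rw [this, mul_comm (-Λ⁻¹), this]
  module

/-- The linearization of the eigenvalue equation at `(h, Λ(A))`. -/
noncomputable def linearization (hX : Hypotheses T ev) (A h : X) (ν : Measure Ω)
    [IsFiniteMeasure ν] : X × ℝ →L[ℝ] X × ℝ :=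
  (hX.transferOp A ∘L ContinuousLinearMap.fst ℝ X ℝ -
    (leadingEigenvalue T ev A • ContinuousLinearMap.fst ℝ X ℝ +
      (ContinuousLinearMap.snd ℝ X ℝ).smulRight h)).prod
    (hX.integralCLM ν ∘L ContinuousLinearMap.fst ℝ X ℝ)

/-- `X` splits as `ℝ h ⊕ ker ν`, and `L_A - Λ` is bijective on `ker ν`. The scalar variable supplies
the missing direction `h` in the range, and the condition on `∫ · dν` fixes the multiple of `h` lost
in the kernel. The inverse is bounded by the open mapping theorem. -/
theorem isInvertible_linearization (hX : Hypotheses T ev) {A h : X} {ν : Measure Ω}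
    [IsFiniteMeasure ν] (H : IsRPFData T ev A h ν) : (hX.linearization A h ν).IsInvertible := by
  have happ : ∀ p : X × ℝ, hX.linearization A h ν p =
      (hX.transferOp A p.1 - (leadingEigenvalue T ev A • p.1 + p.2 • h),
        hX.integralCLM ν p.1) := fun p => rfl
  have hint : ∀ f, hX.integralCLM ν (hX.transferOp A f) =
      leadingEigenvalue T ev A * hX.integralCLM ν f := hX.integral_transferOp H
  have hh : hX.integralCLM ν h = 1 := H.normalized
  have hbij : Function.Bijective (hX.linearization A h ν) := by
    refine ⟨(injective_iff_map_eq_zero _).2 ?_, ?_⟩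
    · rintro ⟨g, s⟩ hgs
      rw [happ, Prod.mk_eq_zero] at hgs
      obtain ⟨h1, h2⟩ := hgs
      -- Integration against `ν` annihilates `(L_A - Λ) g` and leaves only `s`.
      have h3 := congrArg (hX.integralCLM ν) h1
      simp only [map_sub, map_add, map_smul, hint, hh, smul_eq_mul, map_zero] at h3 h2
      obtain rfl : s = 0 := by
        rw [h2] at h3
        linarith
      rw [zero_smul, add_zero, sub_eq_zero] at h1
      rw [hX.eq_zero_of_transferOp_eq H h2 h1]
      rfl
    · rintro ⟨y, s⟩
      obtain ⟨g, hg⟩ := hX.exists_transferOp_sub_eq H (y := y - hX.integralCLM ν y • h) (by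
        rw [← hX.integralCLM_apply]
        simp only [map_sub, map_smul, hh, smul_eq_mul, mul_one, sub_self])
      refine ⟨(g + (s - hX.integralCLM ν g) • h, -hX.integralCLM ν y), ?_⟩
      rw [happ]
      refine Prod.ext ?_ ?_
      · simp only [map_add, map_smul, hX.transferOp_eigenfunction H]
        rw [eq_add_of_sub_eq hg]
        module
      · simp only [map_add, map_smul, hh, smul_eq_mul]
        ring
  exact ⟨ContinuousLinearEquiv.ofBijective _ (LinearMap.ker_eq_bot.2 hbij.1)
    (LinearMap.range_eq_top.2 hbij.2), by ext <;> rfl⟩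

/-- The leading eigenvalue and a suitably normalized eigenfunction depend analytically on the
potential. -/
theorem exists_analyticAt_eigenfunction (hX : Hypotheses T ev) {A h : X} {ν : Measure Ω}
    (H : IsRPFData T ev A h ν) : ∃ E : X → X, E A = h ∧ AnalyticAt ℝ E A ∧
      AnalyticAt ℝ (fun B => leadingEigenvalue T ev B) A ∧
      ∀ᶠ B in 𝓝 A, (∃ c : ℝ, 0 < c ∧ ∀ x, c ≤ ev (E B) x) ∧
        hX.transferOp B (E B) = leadingEigenvalue T ev B • E B := by
  have := H.isProbabilityMeasure
  set Λ := leadingEigenvalue T ev A with hΛ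
  -- The eigenvalue equation together with a normalization against the fixed measure `ν` of the base
  -- point `A`, not against the eigenmeasure of the varying potential.
  let F : X × (X × ℝ) → X × ℝ := fun p =>
    (hX.transferOp p.1 p.2.1 - p.2.2 • p.2.1, hX.integralCLM ν p.2.1)
  have hexp : ContDiff ℝ ω (NormedSpace.exp : X → X) :=
    contDiff_iff_contDiffAt.2 fun x => (NormedSpace.exp_analytic (𝕂 := ℝ) x).contDiffAt
  have hF : ContDiff ℝ ω F := by
    have h1 : ContDiff ℝ ω fun p : X × (X × ℝ) => NormedSpace.exp p.1 := hexp.comp contDiff_fst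
    have h2 : ContDiff ℝ ω fun p : X × (X × ℝ) => hX.transferOp p.1 p.2.1 :=
      hX.sumOp.contDiff.comp (h1.mul (by fun_prop))
    refine ContDiff.prodMk (h2.sub (by fun_prop)) (by fun_prop)
  have hFA : ContDiffAt ℝ ω F (A, (h, Λ)) := hF.contDiffAt
  have hω : (ω : WithTop ℕ∞) ≠ 0 := by simp
  have hlin : fderiv ℝ F (A, (h, Λ)) ∘L .inr ℝ X (X × ℝ) = hX.linearization A h ν := by
    have h1 : HasFDerivAt (fun q : X × ℝ => F (A, q))
        (fderiv ℝ F (A, (h, Λ)) ∘L .inr ℝ X (X × ℝ)) (h, Λ) :=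
      (hFA.differentiableAt hω).hasFDerivAt.comp (h, Λ) (hasFDerivAt_prodMk_right A (h, Λ))
    refine h1.unique ?_
    refine HasFDerivAt.prodMk (HasFDerivAt.sub ?_ ?_) ?_
    · exact (hX.transferOp A ∘L ContinuousLinearMap.fst ℝ X ℝ).hasFDerivAt
    · exact (hasFDerivAt_snd (𝕜 := ℝ) (p := (h, Λ))).smul hasFDerivAt_fst
    · exact (hX.integralCLM ν ∘L ContinuousLinearMap.fst ℝ X ℝ).hasFDerivAt
  have hinv : (fderiv ℝ F (A, (h, Λ)) ∘L .inr ℝ X (X × ℝ)).IsInvertible :=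
    hlin ▸ hX.isInvertible_linearization H
  set ψ := hFA.implicitFunction hω hinv
  have hψA : ψ A = (h, Λ) := hFA.implicitFunction_apply_self hω hinv
  have hψ : AnalyticAt ℝ ψ A :=
    (hFA.contDiffAt_implicitFunction hω hinv).analyticAt
  have hψ1 : AnalyticAt ℝ (fun B => (ψ B).1) A := analyticAt_fst.comp hψ
  have hψ2 : AnalyticAt ℝ (fun B => (ψ B).2) A := analyticAt_snd.comp hψ
  obtain ⟨c, hc, hch⟩ := H.bounded_away
  obtain ⟨C, hC, hCf⟩ := hX.exists_abs_ev_le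
  -- The norm dominates the sup norm, so eigenfunctions near `h` stay bounded below; positivity then
  -- identifies their eigenvalue as the leading one.
  have hpos : ∀ᶠ B in 𝓝 A, ∃ c : ℝ, 0 < c ∧ ∀ x, c ≤ ev (ψ B).1 x := by
    have h1 : ∀ᶠ B in 𝓝 A, dist (ψ B).1 h < c / (2 * C) := by
      have h2 : Tendsto (fun B => (ψ B).1) (𝓝 A) (𝓝 h) := by
        have := hψ1.continuousAt.tendsto
        rwa [hψA] at this
      exact Metric.tendsto_nhds.1 h2 _ (by positivity)
    filter_upwards [h1] with B hB
    refine ⟨c / 2, by positivity, fun x => ?_⟩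
    have h2 := hCf ((ψ B).1 - h) x
    rw [dist_eq_norm, lt_div_iff₀ (by positivity)] at hB
    have h3 := (abs_le.1 h2).1
    have h4 := hch x
    simp only [map_sub, Pi.sub_apply] at h3
    nlinarith
  have heig : ∀ᶠ B in 𝓝 A, hX.transferOp B (ψ B).1 = (ψ B).2 • (ψ B).1 := by
    filter_upwards [hFA.eventually_apply_implicitFunction hω hinv] with B hB
    have h1 := congrArg Prod.fst hB
    simp only [F] at h1
    rw [hX.transferOp_eigenfunction H, sub_self, sub_eq_zero] at h1
    exact h1
  have hval : ∀ᶠ B in 𝓝 A, (ψ B).2 = leadingEigenvalue T ev B := by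
    filter_upwards [hpos, heig] with B h1 h2
    exact hX.eq_leadingEigenvalue h1 h2
  refine ⟨fun B => (ψ B).1, by simp [hψA], hψ1, hψ2.congr hval, ?_⟩
  filter_upwards [hpos, heig, hval] with B h1 h2 h3
  exact ⟨h1, h3 ▸ h2⟩

theorem analyticAt_log_leadingEigenvalue (hX : Hypotheses T ev) (A : X) :
    AnalyticAt ℝ (fun B => Real.log (leadingEigenvalue T ev B)) A := by
  obtain ⟨h, ν, H⟩ := hX.rpf A
  obtain ⟨E, -, -, h1, -⟩ := hX.exists_analyticAt_eigenfunction H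
  exact (analyticAt_log (hX.leadingEigenvalue_pos A)).comp h1

end Hypotheses

end Perturbation

end Thermo

/-! ### Second-order nondegeneracy of the pressure -/

namespace Thermo

open Filter Topology

/-- Square `e^{s/2} ≥ 1 + s/2`, whose right side is nonnegative exactly when `s ≥ -2`. -/
theorem sq_div_four_le_exp_sub {s : ℝ} (hs : -2 ≤ s) : s ^ 2 / 4 ≤ Real.exp s - 1 - s := by
  have h1 := Real.add_one_le_exp (s / 2)
  have h2 : Real.exp s = Real.exp (s / 2) ^ 2 := by
    rw [← Real.exp_nat_mul]
    congr 1
    push_cast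
    ring
  nlinarith

section SecondOrder

variable {Ω X : Type*} [MetricSpace Ω] [CompactSpace Ω] [MeasurableSpace Ω] [BorelSpace Ω]
  [NormedCommRing X] [NormedAlgebra ℝ X] [CompleteSpace X] {T : Ω → Ω} {ev : X →ₐ[ℝ] (Ω → ℝ)}

namespace Hypotheses

/-- Differentiating the normalized potential along a line: `V` minus a coboundary is the pointwise
derivative of functions controlling the convexity defect of the pressure. -/
theorem exists_hasDerivAt_normalization (hX : Hypotheses T ev) (A V : X) :
    ∃ (W : X) (u : ℝ → Ω → ℝ), V - W ∈ coboundaries T ev ∧ (∀ t, Measurable (u t)) ∧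
      (∀ x, HasDerivAt (fun t => u t x) (ev W x) 0) ∧ (∀ x, u 0 x = 0) ∧
      ∀ᶠ t in 𝓝 (0 : ℝ), Integrable (fun x => Real.exp (u t x) - 1 - u t x) (gibbsMeasure T ev A) ∧
        ∫ x, (Real.exp (u t x) - 1 - u t x) ∂(gibbsMeasure T ev A) =
          Real.log (leadingEigenvalue T ev (A + t • V)) - Real.log (leadingEigenvalue T ev A) -
            t * ∫ x, ev V x ∂(gibbsMeasure T ev A) := by
  have := hX.isProbabilityMeasure_gibbs A
  obtain ⟨h, ν, H, e⟩ := hX.isGibbsMeasure A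
  obtain ⟨E, hE0, hE, -, hEv⟩ := hX.exists_analyticAt_eigenfunction H
  obtain ⟨c, hc, hch⟩ := H.bounded_away
  obtain ⟨gA, A', hgA, hA⟩ :=
    hX.exists_normalization H.bounded_away (hX.transferOp_eigenfunction H)
  have hi := hX.integral_transfer_gibbs H e hgA hA
  have hline : HasDerivAt (fun t : ℝ => A + t • V) V 0 := by
    simpa using ((hasDerivAt_id (0 : ℝ)).smul_const V).const_add A
  have hline0 : A + (0 : ℝ) • V = A := by simp
  have hE' : HasDerivAt (fun t : ℝ => E (A + t • V)) (fderiv ℝ E A V) 0 :=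
    HasFDerivAt.comp_hasDerivAt_of_eq (0 : ℝ) hE.differentiableAt.hasFDerivAt hline hline0.symm
  set p : X → ℝ := fun B => Real.log (leadingEigenvalue T ev B) with hp
  have hp' : HasDerivAt (fun t : ℝ => p (A + t • V)) (fderiv ℝ p A V) 0 :=
    HasFDerivAt.comp_hasDerivAt_of_eq (0 : ℝ)
      (hX.analyticAt_log_leadingEigenvalue A).differentiableAt.hasFDerivAt hline hline0.symm
  -- `k` is the derivative of `log E` along `V`; as `h = exp gA`, dividing by `h` is multiplying by
  -- `exp (-gA)`, which stays in `X`.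
  set k : X := fderiv ℝ E A V * NormedSpace.exp (-gA) with hk
  have hkev : ∀ x, ev k x = ev (fderiv ℝ E A V) x / ev h x := fun x => by
    simp [hk, hX.ev_exp, Real.exp_neg, hgA, div_eq_mul_inv]
  obtain ⟨kT, hkT⟩ := hX.exists_comp k
  have hlog : ∀ x, HasDerivAt (fun t : ℝ => Real.log (ev (E (A + t • V)) x)) (ev k x) 0 := fun x => by
    have h1 : HasDerivAt (fun t : ℝ => ev (E (A + t • V)) x) (ev (fderiv ℝ E A V) x) 0 :=
      (hX.evCLM x).hasFDerivAt.comp_hasDerivAt (0 : ℝ) hE'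
    have h2 := h1.log (by simpa [hE0] using (hc.trans_le (hch x)).ne')
    simpa [hE0, hkev] using h2
  -- For small `t` the function `u t` is the difference of the normalized potentials of `A + t V`
  -- and `A`. Writing it with logarithms keeps it defined and measurable for all `t`, even where `E`
  -- is not positive.
  refine ⟨V + k - kT - algebraMap ℝ X (fderiv ℝ p A V), fun t x => t * ev V x +
    (Real.log (ev (E (A + t • V)) x) - Real.log (ev h x)) -
    (Real.log (ev (E (A + t • V)) (T x)) - Real.log (ev h (T x))) - (p (A + t • V) - p A),
    ⟨-k, fderiv ℝ p A V, fun x => ?_⟩, fun t => ?_, fun x => ?_, fun x => ?_, ?_⟩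
  · simp [hkT]
    ring
  · have h1 : ∀ f : X, Measurable fun x => Real.log (ev f x) := fun f => (hX.measurable f).log
    have h2 : ∀ f : X, Measurable fun x => Real.log (ev f (T x)) := fun f =>
      (h1 f).comp hX.measurable_map
    exact ((((hX.measurable V).const_mul t).add ((h1 _).sub (h1 _))).sub
      ((h2 _).sub (h2 _))).sub_const _
  · have h1 := ((((hasDerivAt_id (0 : ℝ)).mul_const (ev V x)).add
      ((hlog x).sub_const (Real.log (ev h x)))).sub
      ((hlog (T x)).sub_const (Real.log (ev h (T x))))).sub (hp'.sub_const (p A))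
    convert! h1 using 1
    simp [hkT]
  · simp [hE0]
  · have h1 : Tendsto (fun t : ℝ => A + t • V) (𝓝 0) (𝓝 A) := by
      simpa using hline.continuousAt.tendsto
    filter_upwards [h1.eventually hEv] with t ht
    obtain ⟨g, B, hg, hB⟩ := hX.exists_normalization ht.1 ht.2
    have hfun : (fun x => Real.exp (t * ev V x +
        (Real.log (ev (E (A + t • V)) x) - Real.log (ev h x)) -
        (Real.log (ev (E (A + t • V)) (T x)) - Real.log (ev h (T x))) - (p (A + t • V) - p A)) - 1 -
        (t * ev V x + (Real.log (ev (E (A + t • V)) x) - Real.log (ev h x)) -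
        (Real.log (ev (E (A + t • V)) (T x)) - Real.log (ev h (T x))) - (p (A + t • V) - p A))) =
        ev (NormedSpace.exp (B - A') - 1 - (B - A')) := by
      ext x
      have hu : t * ev V x + (Real.log (ev (E (A + t • V)) x) - Real.log (ev h x)) -
          (Real.log (ev (E (A + t • V)) (T x)) - Real.log (ev h (T x))) - (p (A + t • V) - p A) =
          ev (B - A') x := by
        simp only [← hg, ← hgA, Real.log_exp, map_sub, map_add, map_smul, Pi.sub_apply,
          Pi.add_apply, Pi.smul_apply, smul_eq_mul, hB.ev_eq, hA.ev_eq, hp]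
        ring
      rw [hu]
      simp [hX.ev_exp]
    rw [hfun]
    refine ⟨hX.integrable _ _, ?_⟩
    rw [hX.integral_exp_sub hA hi hB]
    simp [integral_const_mul]

/-- If the pressure is affine to second order in the direction `V`, then `V` is cohomologous to a
constant. -/
theorem mem_coboundaries_of_tendsto (hX : Hypotheses T ev) {A V : X} {t : ℕ → ℝ}
    (ht0 : ∀ n, t n ≠ 0) (ht : Tendsto t atTop (𝓝 0))
    (h : Tendsto (fun n => (Real.log (leadingEigenvalue T ev (A + t n • V)) -
      Real.log (leadingEigenvalue T ev A) - t n * ∫ x, ev V x ∂(gibbsMeasure T ev A)) / t n ^ 2)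
      atTop (𝓝 0)) : V ∈ coboundaries T ev := by
  have := hX.isProbabilityMeasure_gibbs A
  obtain ⟨W, u, hVW, hum, hu', hu0, hint⟩ := hX.exists_hasDerivAt_normalization A V
  set μ := gibbsMeasure T ev A
  set F : ℕ → Ω → ENNReal := fun n x =>
    ENNReal.ofReal ((Real.exp (u (t n) x) - 1 - u (t n) x) / t n ^ 2) with hF
  have hFm : ∀ n, Measurable (F n) := fun n =>
    ((((hum (t n)).exp.sub_const 1).sub (hum (t n))).div_const _).ennreal_ofReal
  -- Fatou's lemma needs only this pointwise lower bound, so differentiability of `u` at each point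
  -- suffices, with no uniformity in `x`.
  have hle : ∀ x, ENNReal.ofReal (ev W x ^ 2 / 4) ≤ liminf (fun n => F n x) atTop := fun x => by
    have h1 : Tendsto (fun n => u (t n) x / t n) atTop (𝓝 (ev W x)) := by
      have h2 := (hasDerivAt_iff_tendsto_slope.1 (hu' x)).comp
        (tendsto_nhdsWithin_iff.2 ⟨ht, Eventually.of_forall ht0⟩)
      refine h2.congr fun n => ?_
      simp [slope_def_field, hu0]
    have h2 : Tendsto (fun n => ENNReal.ofReal ((u (t n) x / t n) ^ 2 / 4)) atTop
        (𝓝 (ENNReal.ofReal (ev W x ^ 2 / 4))) :=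
      ENNReal.tendsto_ofReal ((h1.pow 2).div_const 4)
    rw [← h2.liminf_eq]
    have h3 : Tendsto (fun n => u (t n) x) atTop (𝓝 0) := by
      have := (hu' x).continuousAt.tendsto.comp ht
      rwa [hu0] at this
    refine liminf_le_liminf ?_
    filter_upwards [h3.eventually_const_le (by norm_num : (-2 : ℝ) < 0)] with n hn
    refine ENNReal.ofReal_le_ofReal ?_
    rw [div_pow, div_right_comm]
    exact div_le_div_of_nonneg_right (sq_div_four_le_exp_sub hn) (sq_nonneg _)
  have hlim : Tendsto (fun n => ∫⁻ x, F n x ∂μ) atTop (𝓝 0) := by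
    have h1 := ENNReal.tendsto_ofReal h
    rw [ENNReal.ofReal_zero] at h1
    refine h1.congr' ?_
    filter_upwards [ht.eventually hint] with n hn
    rw [← hn.2, ← integral_div, ofReal_integral_eq_lintegral_ofReal (hn.1.div_const _)]
    refine ae_of_all _ fun x => div_nonneg ?_ (sq_nonneg _)
    have := Real.add_one_le_exp (u (t n) x)
    linarith
  have hzero : ∫⁻ x, ENNReal.ofReal (ev W x ^ 2 / 4) ∂μ = 0 := by
    refine le_antisymm ?_ bot_le
    calc ∫⁻ x, ENNReal.ofReal (ev W x ^ 2 / 4) ∂μ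
        ≤ ∫⁻ x, liminf (fun n => F n x) atTop ∂μ := lintegral_mono hle
      _ ≤ liminf (fun n => ∫⁻ x, F n x ∂μ) atTop := lintegral_liminf_le hFm
      _ = 0 := hlim.liminf_eq
  have hW2 : W ^ 2 = 0 := by
    refine hX.faithful A _ (fun x => by simpa using sq_nonneg _) ?_
    rw [lintegral_eq_zero_iff
      (((hX.measurable W).pow_const 2).div_const 4).ennreal_ofReal] at hzero
    refine integral_eq_zero_of_ae ?_
    filter_upwards [hzero] with x hx
    have h1 := ENNReal.ofReal_eq_zero.1 hx
    have h2 := sq_nonneg (ev W x)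
    simp only [map_pow, Pi.pow_apply, Pi.zero_apply]
    linarith
  have hW : W = 0 := hX.ext fun x => by
    have := congrFun (congrArg ev hW2) x
    simpa using this
  simpa [hW] using hVW

end Hypotheses

end SecondOrder

end Thermo

/-! ### The gradient of the pressure and its inverse -/

namespace Thermo

open Filter Topology

section Rotation

variable {Ω X : Type*} [MetricSpace Ω] [CompactSpace Ω] [MeasurableSpace Ω] [BorelSpace Ω]
  [NormedCommRing X] [NormedAlgebra ℝ X] [CompleteSpace X] {T : Ω → Ω} {ev : X →ₐ[ℝ] (Ω → ℝ)}
  {K : ℕ} {φ : Fin K → X}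

/-- The pressure `b ↦ log Λ(∑ b_k φ_k)`. -/
noncomputable def pressure (T : Ω → Ω) (ev : X →ₐ[ℝ] (Ω → ℝ)) (φ : Fin K → X)
    (b : Fin K → ℝ) : ℝ :=
  Real.log (leadingEigenvalue T ev (∑ k, b k • φ k))

/-- The rotation vector of the Gibbs measure of `∑ b_k φ_k`. -/
noncomputable def gibbsRv (T : Ω → Ω) (ev : X →ₐ[ℝ] (Ω → ℝ)) (φ : Fin K → X)
    (b : Fin K → ℝ) : Fin K → ℝ :=
  rv ev φ (gibbsMeasure T ev (∑ k, b k • φ k))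

theorem eq_zero_of_sum_smul_mem
    (hφ : LinearIndependent ℝ (fun k => (coboundaries T ev).mkQ (φ k))) {v : Fin K → ℝ}
    (hv : ∑ k, v k • φ k ∈ coboundaries T ev) : v = 0 := by
  refine funext fun k => Fintype.linearIndependent_iff.1 hφ v ?_ k
  rw [← (Submodule.Quotient.mk_eq_zero _).2 hv, ← Submodule.mkQ_apply]
  simp

/-- `1 ≤ K` provides a nonzero class, which the positivity of the entropy requires. -/
theorem coboundaries_ne_top (hK : 1 ≤ K)
    (hφ : LinearIndependent ℝ (fun k => (coboundaries T ev).mkQ (φ k))) :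
    coboundaries T ev ≠ ⊤ := fun h => by
  have := hφ.ne_zero ⟨0, hK⟩
  rw [Submodule.mkQ_apply, Ne, Submodule.Quotient.mk_eq_zero, h] at this
  exact this Submodule.mem_top

theorem sub_sum_smul (b c : Fin K → ℝ) :
    ∑ k, c k • φ k - ∑ k, b k • φ k = ∑ k, (c k - b k) • φ k := by
  simp only [sub_smul, Finset.sum_sub_distrib]

theorem add_smul_sum_smul (b v : Fin K → ℝ) (t : ℝ) :
    ∑ k, (b + t • v) k • φ k = ∑ k, b k • φ k + t • ∑ k, v k • φ k := by
  simp only [Pi.add_apply, Pi.smul_apply, add_smul, Finset.sum_add_distrib, smul_assoc,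
    Finset.smul_sum]

namespace Hypotheses

theorem integral_sum_smul (hX : Hypotheses T ev) (μ : Measure Ω) [IsFiniteMeasure μ]
    (b : Fin K → ℝ) : ∫ x, ev (∑ k, b k • φ k) x ∂μ = ∑ k, b k * rv ev φ μ k := by
  rw [← hX.integralCLM_apply, map_sum]
  simp only [map_smul, integralCLM_apply, smul_eq_mul, rv]

theorem pressure_sub_ge (hX : Hypotheses T ev) (b c : Fin K → ℝ) :
    ∑ k, (c k - b k) * gibbsRv T ev φ b k ≤ pressure T ev φ c - pressure T ev φ b := by
  have := hX.isProbabilityMeasure_gibbs (∑ k, b k • φ k)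
  have h1 := hX.gibbs_inequality (∑ k, b k • φ k) (∑ k, c k • φ k)
  rwa [sub_sum_smul, hX.integral_sum_smul] at h1

theorem analyticAt_pressure (hX : Hypotheses T ev) (b : Fin K → ℝ) :
    AnalyticAt ℝ (pressure T ev φ) b := by
  have h1 : AnalyticAt ℝ (fun b : Fin K → ℝ => ∑ k, b k • φ k) b :=
    (∑ k, (ContinuousLinearMap.proj (R := ℝ) (φ := fun _ : Fin K => ℝ) k).smulRight (φ k)
      ).analyticAt b |>.congr (Eventually.of_forall fun c => by
        simp)
  exact (hX.analyticAt_log_leadingEigenvalue _).comp h1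

/-- The pressure minus its subgradient functional is minimal at `b`, and it is differentiable there,
so the derivative equals the subgradient. -/
theorem fderiv_pressure (hX : Hypotheses T ev) (b v : Fin K → ℝ) :
    fderiv ℝ (pressure T ev φ) b v = ∑ k, v k * gibbsRv T ev φ b k := by
  set ℓ : (Fin K → ℝ) →L[ℝ] ℝ :=
    ∑ k, gibbsRv T ev φ b k • ContinuousLinearMap.proj (R := ℝ) (φ := fun _ : Fin K => ℝ) k
    with hℓ
  have hℓv : ∀ v, ℓ v = ∑ k, v k * gibbsRv T ev φ b k := fun v => by
    simp [hℓ, mul_comm]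
  have h1 : HasFDerivAt (fun c => pressure T ev φ c - ℓ c) (fderiv ℝ (pressure T ev φ) b - ℓ) b :=
    (hX.analyticAt_pressure b).differentiableAt.hasFDerivAt.sub ℓ.hasFDerivAt
  have h2 : IsLocalMin (fun c => pressure T ev φ c - ℓ c) b := by
    refine Eventually.of_forall fun c => ?_
    have h3 := hX.pressure_sub_ge (φ := φ) b c
    have h4 : ∑ k, (c k - b k) * gibbsRv T ev φ b k = ℓ c - ℓ b := by
      rw [← map_sub, hℓv]
      simp
    simp only
    linarith
  rw [sub_eq_zero.1 (h2.hasFDerivAt_eq_zero h1), hℓv]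

theorem analyticAt_gibbsRv (hX : Hypotheses T ev) (b : Fin K → ℝ) :
    AnalyticAt ℝ (gibbsRv T ev φ) b := by
  refine AnalyticAt.pi fun k => ?_
  have h1 := (ContinuousLinearMap.apply ℝ ℝ (Pi.single k (1 : ℝ) : Fin K → ℝ)).analyticAt
    (fderiv ℝ (pressure T ev φ) b) |>.comp (hX.analyticAt_pressure (φ := φ) b).fderiv
  refine h1.congr (Eventually.of_forall fun c => ?_)
  simp [hX.fderiv_pressure, Pi.single_apply]

/-- With a common rotation vector, the Gibbs inequalities from `b` to `c` and from `c` to `b` bound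
the pressure difference from both sides by the same number. The equality case and linear
independence give `b = c`. -/
theorem gibbsRv_injective (hX : Hypotheses T ev)
    (hφ : LinearIndependent ℝ (fun k => (coboundaries T ev).mkQ (φ k))) :
    Function.Injective (gibbsRv T ev φ) := fun b c hbc => by
  have := hX.isProbabilityMeasure_gibbs (∑ k, b k • φ k)
  have h1 := hX.pressure_sub_ge (φ := φ) b c
  have h2 := hX.pressure_sub_ge (φ := φ) c b
  have h3 : ∑ k, (b k - c k) * gibbsRv T ev φ c k = -∑ k, (c k - b k) * gibbsRv T ev φ b k := by
    rw [hbc, ← Finset.sum_neg_distrib]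
    exact Finset.sum_congr rfl fun k _ => by ring
  have h4 : ∑ k, c k • φ k - ∑ k, b k • φ k ∈ coboundaries T ev := by
    refine hX.sub_mem_coboundaries ?_
    rw [sub_sum_smul, hX.integral_sum_smul]
    change ∑ k, (c k - b k) * gibbsRv T ev φ b k = pressure T ev φ c - pressure T ev φ b
    linarith
  rw [sub_sum_smul] at h4
  have h5 := eq_zero_of_sum_smul_mem hφ (v := c - b) h4
  exact (sub_eq_zero.1 h5).symm

/-- Let `q` be the directional derivative of the pressure along `b + s v`. The subgradient
inequalities at both ends give `0 ≤ P(b + t v) - P(b) - t q(0) ≤ t (q(t) - q(0))`. If `v` is in the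
kernel then `q'(0) = 0`, the middle term is `o(t²)`, and `∑ v_k φ_k` is cohomologous to a constant.
-/
theorem fderiv_gibbsRv_injective (hX : Hypotheses T ev)
    (hφ : LinearIndependent ℝ (fun k => (coboundaries T ev).mkQ (φ k))) (b : Fin K → ℝ) :
    Function.Injective (fderiv ℝ (gibbsRv T ev φ) b) := by
  have := hX.isProbabilityMeasure_gibbs (∑ k, b k • φ k)
  refine (injective_iff_map_eq_zero _).2 fun v hv => eq_zero_of_sum_smul_mem hφ ?_
  set q : ℝ → ℝ := fun s => ∑ k, v k * gibbsRv T ev φ (b + s • v) k with hq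
  have hq' : HasDerivAt q 0 0 := by
    have h1 : HasDerivAt (fun s : ℝ => gibbsRv T ev φ (b + s • v)) 0 0 := by
      have h2 : HasDerivAt (fun s : ℝ => b + s • v) v 0 := by
        simpa using ((hasDerivAt_id (0 : ℝ)).smul_const v).const_add b
      have h3 := HasFDerivAt.comp_hasDerivAt_of_eq (0 : ℝ)
        (hX.analyticAt_gibbsRv (φ := φ) b).differentiableAt.hasFDerivAt h2 (by simp)
      rwa [hv] at h3
    have h4 := HasDerivAt.fun_sum (u := Finset.univ) fun k _ =>
      ((hasDerivAt_pi.1 h1) k).const_mul (v k)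
    simpa using h4
  set t : ℕ → ℝ := fun n => 1 / ((n : ℝ) + 1) with ht
  have htpos : ∀ n, 0 < t n := fun n => by positivity
  have htlim : Tendsto t atTop (𝓝 0) := tendsto_one_div_add_atTop_nhds_zero_nat
  refine hX.mem_coboundaries_of_tendsto (A := ∑ k, b k • φ k) (fun n => (htpos n).ne') htlim ?_
  have hslope : Tendsto (fun n => (q (t n) - q 0) / t n) atTop (𝓝 0) := by
    have h2 := (hasDerivAt_iff_tendsto_slope.1 hq').comp
      (tendsto_nhdsWithin_iff.2 ⟨htlim, Eventually.of_forall fun n => (htpos n).ne'⟩)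
    refine h2.congr fun n => ?_
    simp [slope_def_field]
  have hq0 : q 0 = ∑ k, v k * gibbsRv T ev φ b k := by simp [hq]
  rw [hX.integral_sum_smul]
  refine squeeze_zero (fun n => ?_) (fun n => ?_) hslope
  · have h1 := hX.pressure_sub_ge (φ := φ) b (b + t n • v)
    have h2 : ∑ k, ((b + t n • v) k - b k) * gibbsRv T ev φ b k =
        t n * ∑ k, v k * gibbsRv T ev φ b k := by
      rw [Finset.mul_sum]
      exact Finset.sum_congr rfl fun k _ => by simp [mul_assoc]
    rw [h2] at h1
    simp only [pressure, add_smul_sum_smul] at h1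
    exact div_nonneg (sub_nonneg.2 h1) (sq_nonneg _)
  · have h1 := hX.pressure_sub_ge (φ := φ) (b + t n • v) b
    have h2 : ∑ k, (b k - (b + t n • v) k) * gibbsRv T ev φ (b + t n • v) k = -(t n * q (t n)) := by
      rw [hq, Finset.mul_sum, ← Finset.sum_neg_distrib]
      exact Finset.sum_congr rfl fun k _ => by simp [mul_assoc]
    rw [h2] at h1
    simp only [pressure, add_smul_sum_smul] at h1
    change (_ - _ - t n * ∑ k, v k * gibbsRv T ev φ b k) / _ ≤ _
    rw [← hq0, div_le_div_iff₀ (pow_pos (htpos n) 2) (htpos n)]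
    have := htpos n
    have h3 : Real.log (leadingEigenvalue T ev (∑ k, b k • φ k + t n • ∑ k, v k • φ k)) -
        Real.log (leadingEigenvalue T ev (∑ k, b k • φ k)) - t n * q 0 ≤
        (q (t n) - q 0) * t n := by linarith
    calc _ ≤ (q (t n) - q 0) * t n * t n := mul_le_mul_of_nonneg_right h3 this.le
      _ = _ := by ring

/-- Since `w` is interior, `b ↦ P(b) - ⟨b, w⟩` grows at least like `ε ‖b‖`; at its minimizer the
gradient of `P` equals `w`. -/
theorem exists_gibbsRv_eq (hX : Hypotheses T ev) {w : Fin K → ℝ}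
    (hw : w ∈ interior (Rot T ev φ)) : ∃ b, gibbsRv T ev φ b = w := by
  obtain ⟨ε, hε, hball⟩ := Metric.nhds_basis_closedBall.mem_iff.1 (mem_interior_iff_mem_nhds.1 hw)
  set G : (Fin K → ℝ) → ℝ := fun b => pressure T ev φ b - ∑ k, b k * w k with hG
  have hGb : ∀ b, ε * ‖b‖ ≤ G b := fun b => by
    -- This point of the sup-norm ball pairs with `b` to `⟨b, w⟩ + ε ∑ |b_k|`, and an invariant
    -- measure realizing it bounds the pressure below by that value.
    have h1 : (fun k => w k + ε * SignType.sign (b k)) ∈ Rot T ev φ := by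
      refine hball ?_
      rw [Metric.mem_closedBall, dist_pi_le_iff hε.le]
      intro k
      rw [Real.dist_eq, add_sub_cancel_left, abs_mul, abs_of_pos hε]
      refine mul_le_of_le_one_right hε.le ?_
      rcases SignType.trichotomy (SignType.sign (b k)) with h | h | h <;> simp [h]
    obtain ⟨μ, hμ, hμw⟩ := h1
    have := hμ.1
    have h2 := hX.integral_le_log_leadingEigenvalue hμ (∑ k, b k • φ k)
    rw [hX.integral_sum_smul, hμw] at h2
    have h3 : ∑ k, b k * (w k + ε * SignType.sign (b k)) =
        ∑ k, b k * w k + ε * ∑ k, |b k| := by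
      rw [Finset.mul_sum, ← Finset.sum_add_distrib]
      refine Finset.sum_congr rfl fun k _ => ?_
      rw [← self_mul_sign (b k)]
      ring
    have h4 : ‖b‖ ≤ ∑ k, |b k| := by
      refine (pi_norm_le_iff_of_nonneg (Finset.sum_nonneg fun k _ => abs_nonneg _)).2 fun k => ?_
      exact Finset.single_le_sum (f := fun k => |b k|) (fun k _ => abs_nonneg _)
        (Finset.mem_univ k)
    have h5 := mul_le_mul_of_nonneg_left h4 hε.le
    change _ ≤ Real.log _ - _
    linarith
  have hcont : Continuous G :=
    (continuous_iff_continuousAt.2 fun b => (hX.analyticAt_pressure b).continuousAt).sub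
      (by fun_prop)
  have hlim : Tendsto G (cocompact (Fin K → ℝ)) atTop :=
    tendsto_atTop_mono hGb ((tendsto_norm_cocompact_atTop (E := Fin K → ℝ)).const_mul_atTop hε)
  obtain ⟨b, hb⟩ := hcont.exists_forall_le hlim
  refine ⟨b, ?_⟩
  set ℓ : (Fin K → ℝ) →L[ℝ] ℝ :=
    ∑ k, w k • ContinuousLinearMap.proj (R := ℝ) (φ := fun _ : Fin K => ℝ) k with hℓ
  have hℓv : ∀ v, ℓ v = ∑ k, v k * w k := fun v => by
    simp [hℓ, mul_comm]
  have h1 : HasFDerivAt G (fderiv ℝ (pressure T ev φ) b - ℓ) b := by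
    refine ((hX.analyticAt_pressure b).differentiableAt.hasFDerivAt.sub
      ℓ.hasFDerivAt).congr_of_eventuallyEq (Eventually.of_forall fun c => ?_)
    simp [hG, hℓv]
  have h2 : fderiv ℝ (pressure T ev φ) b = ℓ :=
    sub_eq_zero.1 ((show IsLocalMin G b from Eventually.of_forall hb).hasFDerivAt_eq_zero h1)
  funext k
  have h3 := congrArg (fun L : (Fin K → ℝ) →L[ℝ] ℝ => L (Pi.single k 1)) h2
  simpa [hX.fderiv_pressure, hℓv, Pi.single_apply] using h3

theorem exists_analytic_inverse (hX : Hypotheses T ev)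
    (hφ : LinearIndependent ℝ (fun k => (coboundaries T ev).mkQ (φ k))) :
    ∃ a : (Fin K → ℝ) → (Fin K → ℝ), AnalyticOnNhd ℝ a (interior (Rot T ev φ)) ∧
      ∀ w ∈ interior (Rot T ev φ), gibbsRv T ev φ (a w) = w := by
  have hinj := hX.gibbsRv_injective hφ
  have hinv : ∀ w ∈ interior (Rot T ev φ),
      gibbsRv T ev φ (Function.invFun (gibbsRv T ev φ) w) = w := fun w hw =>
    Function.invFun_eq (hX.exists_gibbsRv_eq hw)
  refine ⟨Function.invFun (gibbsRv T ev φ), fun w hw => ?_, hinv⟩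
  set b := Function.invFun (gibbsRv T ev φ) w
  have han := hX.analyticAt_gibbsRv (φ := φ) b
  let D : (Fin K → ℝ) ≃L[ℝ] (Fin K → ℝ) :=
    (LinearEquiv.ofInjectiveEndo (fderiv ℝ (gibbsRv T ev φ) b).toLinearMap
      (hX.fderiv_gibbsRv_injective hφ b)).toContinuousLinearEquiv
  have hD : HasFDerivAt (gibbsRv T ev φ) (D : (Fin K → ℝ) →L[ℝ] (Fin K → ℝ)) b := by
    convert! han.differentiableAt.hasFDerivAt using 1
  have hω : (⊤ : WithTop ℕ∞) ≠ 0 := by simp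
  have h1 := (han.contDiffAt.to_localInverse hD hω).analyticAt
  rw [hinv w hw] at h1
  refine h1.congr ?_
  have h2 := (han.contDiffAt.hasStrictFDerivAt' hD hω).eventually_right_inverse
  rw [hinv w hw] at h2
  filter_upwards [h2, isOpen_interior.mem_nhds hw] with z hz hzI
  -- Global injectivity identifies the analytic local inverse with the global one.
  exact hinj (hz.trans (hinv z hzI).symm)

/-- The Gibbs measure of `∑ b_k φ_k` maximizes the entropy among the invariant measures with its
rotation vector. -/
theorem isGreatest_entropyValues (hX : Hypotheses T ev) (b : Fin K → ℝ) :
    IsGreatest (entropyValues T ev φ (gibbsRv T ev φ b))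
      (entropy T ev (gibbsMeasure T ev (∑ k, b k • φ k))) := by
  have hμ := hX.gibbsMeasure_mem_invariantMeasures (∑ k, b k • φ k)
  refine ⟨⟨_, ⟨hμ, rfl⟩, rfl⟩, ?_⟩
  rintro _ ⟨μ, ⟨hμ', hμb⟩, rfl⟩
  have := hμ.1
  have := hμ'.1
  -- Testing the infimum at `∑ b_k φ_k` gives a bound depending on `μ` only through its rotation
  -- vector.
  refine (hX.entropy_le hμ' (∑ k, b k • φ k)).trans_eq ?_
  rw [hX.entropy_gibbsMeasure, hX.integral_sum_smul, hX.integral_sum_smul, hμb]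
  rfl

end Hypotheses

end Rotation

end Thermo

/-! ### Entropy on the interior of the rotation set -/

theorem mainTheorem9 {Ω X : Type*} [MetricSpace Ω] [CompactSpace Ω] [MeasurableSpace Ω]
    [BorelSpace Ω] [NormedCommRing X] [NormedAlgebra ℝ X] [CompleteSpace X]
    (T : Ω → Ω) (ev : X →ₐ[ℝ] (Ω → ℝ)) (hX : Thermo.Hypotheses T ev)
    (K : ℕ) (hK : 1 ≤ K) (φ : Fin K → X)
    (hφ : LinearIndependent ℝ (fun k => (Thermo.coboundaries T ev).mkQ (φ k))) :
    -- the infimum defining the entropy is finite, and so is the supremum defining `H`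
    (∀ μ ∈ Thermo.invariantMeasures T, BddBelow (Set.range fun A : X =>
      Real.log (Thermo.leadingEigenvalue T ev A) - ∫ x, ev A x ∂μ)) ∧
    (∀ w ∈ interior (Thermo.Rot T ev φ), IsLUB (Thermo.entropyValues T ev φ w)
      (Thermo.maxEntropy T ev φ w)) ∧
    -- `H` is positive and analytic
    (∀ w ∈ interior (Thermo.Rot T ev φ), 0 < Thermo.maxEntropy T ev φ w) ∧
    AnalyticOnNhd ℝ (Thermo.maxEntropy T ev φ) (interior (Thermo.Rot T ev φ)) ∧
    -- the formula for `H`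
    ∃ a : (Fin K → ℝ) → (Fin K → ℝ),
      AnalyticOnNhd ℝ a (interior (Thermo.Rot T ev φ)) ∧
      ∀ w ∈ interior (Thermo.Rot T ev φ),
        (∀ b : Fin K → ℝ,
          Thermo.rv ev φ (Thermo.gibbsMeasure T ev (∑ k, b k • φ k)) = w ↔ b = a w) ∧
        Thermo.gibbsMeasure T ev (∑ k, a w k • φ k) ∈ Thermo.invariantMeasures T ∧
        Thermo.maxEntropy T ev φ w =
          Thermo.entropy T ev (Thermo.gibbsMeasure T ev (∑ k, a w k • φ k)) ∧
        Thermo.maxEntropy T ev φ w =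
          Real.log (Thermo.leadingEigenvalue T ev (∑ k, a w k • φ k)) - ∑ k, a w k * w k := by
  obtain ⟨a, ha, hinv⟩ := hX.exists_analytic_inverse hφ
  have hgreat : ∀ w ∈ interior (Thermo.Rot T ev φ), IsGreatest (Thermo.entropyValues T ev φ w)
      (Thermo.entropy T ev (Thermo.gibbsMeasure T ev (∑ k, a w k • φ k))) := fun w hw => by
    have := hX.isGreatest_entropyValues (φ := φ) (a w)
    rwa [hinv w hw] at this
  have hmax : ∀ w ∈ interior (Thermo.Rot T ev φ), Thermo.maxEntropy T ev φ w =
      Thermo.entropy T ev (Thermo.gibbsMeasure T ev (∑ k, a w k • φ k)) := fun w hw =>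
    (hgreat w hw).csSup_eq
  have hformula : ∀ w ∈ interior (Thermo.Rot T ev φ), Thermo.maxEntropy T ev φ w =
      Real.log (Thermo.leadingEigenvalue T ev (∑ k, a w k • φ k)) - ∑ k, a w k * w k :=
    fun w hw => by
      have := hX.isProbabilityMeasure_gibbs (∑ k, a w k • φ k)
      have h1 : Thermo.rv ev φ (Thermo.gibbsMeasure T ev (∑ k, a w k • φ k)) = w := hinv w hw
      rw [hmax w hw, hX.entropy_gibbsMeasure, hX.integral_sum_smul, h1]
  refine ⟨fun μ hμ => hX.bddBelow_range hμ, fun w hw => ?_, fun w hw => ?_, fun w hw => ?_,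
    a, ha, fun w hw => ⟨fun b => ⟨fun hb => ?_, ?_⟩, ?_, hmax w hw, hformula w hw⟩⟩
  · rw [hmax w hw]
    exact (hgreat w hw).isLUB
  · rw [hmax w hw]
    exact hX.entropy_gibbsMeasure_pos _ (Thermo.coboundaries_ne_top hK hφ)
  -- The Legendre formula holds throughout the open interior, so analyticity of `H` follows from
  -- that of the pressure and of `a`.
  · have h1 : AnalyticAt ℝ (fun z => Thermo.pressure T ev φ (a z) - ∑ k, a z k * z k) w := by
      refine ((hX.analyticAt_pressure (a w)).comp (ha w hw)).sub
        (Finset.analyticAt_fun_sum _ fun k _ => ?_)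
      exact ((ContinuousLinearMap.proj (R := ℝ) (φ := fun _ : Fin K => ℝ) k).analyticAt _ |>.comp
        (ha w hw)).mul ((ContinuousLinearMap.proj (R := ℝ) (φ := fun _ : Fin K => ℝ) k).analyticAt w)
    refine h1.congr ?_
    filter_upwards [isOpen_interior.mem_nhds hw] with z hz
    exact (hformula z hz).symm
  · exact hX.gibbsRv_injective hφ (hb.trans (hinv w hw).symm)
  · rintro rfl
    exact hinv w hw
  · exact hX.gibbsMeasure_mem_invariantMeasures _
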